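/- Let $\mu$ be the law of a single spin: a symmetric probability measure on $\mathbb R$ with $\mu([-1,1])=1$, and let $h\in\mathbb R$. Let $\sigma=(\sigma_1,\dots,\sigma_n)$ be iid with law $\mu$ (expectation $\mathbf E$), let $(g_{ij})$ be iid standard Gaussian variables and $g$ a standard Gaussian variable (expectation $\mathbf E^{(g)}$ over Gaussian variables). Put $$H_n(\sigma)=\sqrt{\tfrac2n}\sum_{i<j}g_{ij}\sigma_i\sigma_j+\tfrac1{\sqrt n}\sum_i g_{ii}\sigma_i^2,\qquad R(\sigma,\sigma)=\tfrac1n\sum_i\sigma_i^2,$$ and, for $t\ge 0$, $$Z_n(t)=\mathbf E\Big[e^{\sqrt t\,H_n(\sigma)+h\sum_i\sigma_i-\frac t2 nR(\sigma,\sigma)^2}\Big],\qquad \alpha_n(t)=\tfrac1n\,\mathbf E^{(g)}[\log Z_n(t)].$$ Define $\phi$ and $q^{\mathrm{lin}}$ by $$e^{\phi(u,v)}=\mathbf E\big[e^{u\sigma_1+v\sigma_1^2}\big],\qquad q^{\mathrm{lin}}(x)=\mathbf E^{(g)}\big[(\partial_u\phi)^2(h+g\sqrt x,-x/2)\big]\quad(x\ge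 0).$$ Then there is a number $t_c>0$, depending neither on $\mu$ nor on $h$, such that for all such $\mu$ and $h$ and all $0\le t\le t_c$: the variable $\log Z_n(t)$ is integrable for every $n$, the equation $q^{\mathrm{lin}}(2qt)=q$ has exactly one solution $q=q_c(t)$ in $[0,\infty)$, the variable $\phi(h+g\sqrt{2qt},-qt)$ is integrable, and $$\lim_{n\to\infty}\alpha_n(t)=\frac t2q^2+\mathbf E^{(g)}\big[\phi(h+g\sqrt{2qt},-qt)\big].$$ -/

import Mathlib

open MeasureTheory ProbabilityTheory Filter Topology

noncomputable section

namespace GeneralSpinSK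

/-- The mixed Laplace exponent of the single-spin law `μ`, i.e. the function `φ(u, v)` with
`exp (φ(u, v)) = E[exp (u σ + v σ²)]` where `σ` has law `μ`. -/
def phi (μ : Measure ℝ) (u v : ℝ) : ℝ :=
  Real.log (∫ s, Real.exp (u * s + v * s ^ 2) ∂μ)

/-- The partial derivative `∂_u φ (u, v)`. -/
def dphi (μ : Measure ℝ) (u v : ℝ) : ℝ :=
  deriv (fun w => phi μ w v) u

/-- `q^lin(x) = E[(∂_u φ)²(h + g √x, -x/2)]`, with `g` standard Gaussian. -/
def qlin (μ : Measure ℝ) (h x : ℝ) : ℝ :=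
  ∫ g, (dphi μ (h + g * Real.sqrt x) (-x / 2)) ^ 2 ∂(gaussianReal 0 1)

/-- The overlap `(1/n) ∑ᵢ σᵢ τᵢ`. -/
def overlap {n : ℕ} (σ τ : Fin n → ℝ) : ℝ :=
  (1 / (n : ℝ)) * ∑ i, σ i * τ i

/-- The Sherrington-Kirkpatrick Hamiltonian
`√(2/n) ∑_{i<j} g_{ij} σᵢ σⱼ + (1/√n) ∑ᵢ g_{ii} σᵢ²`. -/
def hamiltonian {n : ℕ} (g : Fin n × Fin n → ℝ) (σ : Fin n → ℝ) : ℝ :=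
  Real.sqrt (2 / (n : ℝ)) *
      (∑ p ∈ Finset.univ.filter (fun p : Fin n × Fin n => p.1 < p.2), g p * σ p.1 * σ p.2)
    + (1 / Real.sqrt (n : ℝ)) * ∑ i, g (i, i) * σ i ^ 2

/-- The partition function
`Z_n(t) = E[exp (√t H_n(σ) + h ∑ᵢ σᵢ - (t/2) n q(σ,σ)²)]`, the expectation being over
iid spins `σ₁, …, σₙ` of law `μ`, with the disorder `g` fixed. -/
def partitionFunction (μ : Measure ℝ) (h t : ℝ) (n : ℕ) (g : Fin n × Fin n → ℝ) : ℝ :=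
  ∫ σ : Fin n → ℝ,
    Real.exp (Real.sqrt t * hamiltonian g σ + h * ∑ i, σ i - t / 2 * n * overlap σ σ ^ 2)
    ∂(Measure.pi fun _ => μ)

/-- The law of the disorder: independent standard Gaussian variables `g_{ij}`. -/
def disorder (n : ℕ) : Measure (Fin n × Fin n → ℝ) :=
  Measure.pi fun _ => gaussianReal 0 1

/-- The mean free energy `α_n(t) = (1/n) E[log Z_n(t)]`. -/
def freeEnergy (μ : Measure ℝ) (h t : ℝ) (n : ℕ) : ℝ :=
  (1 / (n : ℝ)) * ∫ g, Real.log (partitionFunction μ h t n g) ∂(disorder n)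

end GeneralSpinSK

end

/-! The proof is a Guerra interpolation controlled by quadratic replica coupling. For a solution `q`
of the fixed point equation, the path `singlePath` joins independent spins in Gaussian fields of
variance `2qt` (at `θ = 0`) to the SK model (at `θ = π/2`), with squared weights `cos² θ` and `sin²
θ`. The deterministic drift cancels the self-overlap terms, so Gaussian integration by parts gives
the sum rule `hasDerivAt_logZ_singlePath`: up to the explicit contribution of `q²`, the derivative
of `logZ` is `-n t sin θ cos θ` times the mean of `(R₁₂ - q)²` over two replicas. Integrated over
the path, the `q²` term yields `n t q² / 2`, and the formula holds as soon as the overlap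
concentrates at `q`.

To show concentration, two replicas sharing the disorder are coupled by `(Λ - 2t sin² θ)(n/2)(R₁₂ -
q)²`. The decrease of the coupling cancels the positive `(R₁₂ - q)²` term created by the path, so
the coupled free energy is controlled by its value at `θ = 0` (`logZ_pairPath_le`). There the sites
are independent and the fixed point equation says that `σᵢτᵢ - q` has mean zero once the field is
averaged too. Hence `√n (R₁₂ - q)` is sub-Gaussian and the coupling costs only a constant `C`
independent of `n` (`logZ_pairPath_zero_le`). Jensen's inequality turns this into a bound on the
overlap variance by `C` and the deficit in the formula, while the sum rule bounds the deficit by `t`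
times the variance. For small `t` this loop closes, giving errors of order one in `logZ` and
variance of order `1/n` (`overlapVar_le_and_logZ_ge`).

A solution `q` exists by the intermediate value theorem. It is unique because the Gibbs measure at
`θ = π/2` does not know `q`: its overlap would otherwise concentrate at two distinct values
(`sq_sub_le_overlapVar_add`). -/

namespace GeneralSpinSK

/-! ### Gaussian integration by parts in one and several variables. -/

section Gaussian

theorem integrable_abs_gaussian : Integrable (fun x : ℝ => |x|) (gaussianReal 0 1) :=
  ((memLp_id_gaussianReal (μ := 0) (v := 1) 1).integrable (by simp)).abs

/-- Gaussian integration by parts for bounded functions with bounded derivative. -/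
theorem gaussian_integral_by_parts {f f' : ℝ → ℝ} {C : ℝ}
    (hf : ∀ x, HasDerivAt f (f' x) x) (hC : ∀ x, |f x| ≤ C) (hC' : ∀ x, |f' x| ≤ C) :
    ∫ x, x * f x ∂(gaussianReal 0 1) = ∫ x, f' x ∂(gaussianReal 0 1) := by
  have hfm : Measurable f := (continuous_iff_continuousAt.2
    fun x => (hf x).continuousAt).measurable
  have hf'm : Measurable f' := by
    have : f' = deriv f := funext fun x => (hf x).deriv.symm
    rw [this]; exact measurable_deriv f
  have key : ∀ F : ℝ → ℝ, Integrable F (gaussianReal 0 1) →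
      Integrable (fun x => F x * gaussianPDFReal 0 1 x) := by
    intro F hF
    rw [gaussianReal_of_var_ne_zero _ one_ne_zero] at hF
    have := (integrable_withDensity_iff (measurable_gaussianPDF 0 1)
      (ae_of_all _ fun x => gaussianPDF_lt_top)).1 hF
    simpa [toReal_gaussianPDF] using this
  have hx : Integrable (fun x : ℝ => x) (gaussianReal 0 1) :=
    (memLp_id_gaussianReal (μ := 0) (v := 1) 1).integrable (by simp)
  have h1 : Integrable f (gaussianReal 0 1) :=
    Integrable.of_bound hfm.aestronglyMeasurable C (ae_of_all _ hC)
  have h2 : Integrable f' (gaussianReal 0 1) :=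
    Integrable.of_bound hf'm.aestronglyMeasurable C (ae_of_all _ hC')
  have h3 : Integrable (fun x => x * f x) (gaussianReal 0 1) :=
    hx.mul_bdd (c := C) hfm.aestronglyMeasurable (ae_of_all _ hC)
  -- The density `ρ` satisfies `ρ' = -xρ`, which reduces the claim to integration by parts on the
  -- line.
  have hpdf : ∀ x, HasDerivAt (gaussianPDFReal 0 1) (-x * gaussianPDFReal 0 1 x) x := by
    intro x
    have hd : HasDerivAt (fun y : ℝ => (√(2 * Real.pi * (1 : NNReal)))⁻¹ *
        Real.exp (-(y - 0) ^ 2 / (2 * (1 : NNReal)))) _ x :=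
      (((((hasDerivAt_id x).sub_const 0).pow 2).neg.div_const (2 * ((1 : NNReal) : ℝ))).exp).const_mul _
    rw [gaussianPDFReal_def]
    convert hd using 1
    simp
    ring
  have := integral_mul_deriv_eq_deriv_mul_of_integrable
    (u := f) (v := gaussianPDFReal 0 1) (u' := f') (v' := fun x => -x * gaussianPDFReal 0 1 x)
    (fun x _ => hf x) (fun x _ => hpdf x)
    (by
      refine (key _ h3).neg.congr (ae_of_all _ fun x => ?_)
      simp only [Pi.neg_apply, Pi.mul_apply]; ring)
    (key _ h2) (key _ h1)
  rw [integral_gaussianReal_eq_integral_smul one_ne_zero,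
    integral_gaussianReal_eq_integral_smul one_ne_zero]
  simp only [smul_eq_mul]
  calc ∫ x, gaussianPDFReal 0 1 x * (x * f x)
      = - ∫ x, f x * (-x * gaussianPDFReal 0 1 x) := by
        rw [← integral_neg]; congr 1; ext x; ring
    _ = ∫ x, gaussianPDFReal 0 1 x * f' x := by
        rw [this, neg_neg]; congr 1; ext x; ring

variable {K : Type*} [Fintype K]

/-- Resampling one coordinate independently preserves the product law. Fubini then isolates that
coordinate, so that the one-variable integration by parts applies to it. -/
theorem measurePreserving_pi_update [DecidableEq K] (ν : Measure ℝ) [IsProbabilityMeasure ν] (k : K) :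
    MeasurePreserving (fun p : (K → ℝ) × ℝ => Function.update p.1 k p.2)
      ((Measure.pi fun _ => ν).prod ν) (Measure.pi fun _ => ν) := by
  have hm : Measurable (fun p : (K → ℝ) × ℝ => Function.update p.1 k p.2) := by
    refine measurable_pi_lambda _ fun i => ?_
    by_cases h : i = k
    · subst h; simpa using measurable_snd
    · simp only [Function.update_of_ne h]; fun_prop
  refine ⟨hm, ?_⟩
  symm
  refine Measure.pi_eq fun s hs => ?_
  rw [Measure.map_apply hm (MeasurableSet.univ_pi hs)]
  have : (fun p : (K → ℝ) × ℝ => Function.update p.1 k p.2) ⁻¹' (Set.univ.pi s)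
      = (Set.univ.pi (Function.update s k Set.univ)) ×ˢ s k := by
    ext p
    simp only [Set.mem_preimage, Set.mem_pi, Set.mem_univ, true_imp_iff, Set.mem_prod]
    constructor
    · intro h
      refine ⟨fun i => ?_, by simpa using h k⟩
      by_cases hi : i = k
      · subst hi; simp
      · simpa [Function.update_of_ne hi] using h i
    · rintro ⟨h1, h2⟩ i
      by_cases hi : i = k
      · subst hi; simpa using h2
      · simpa [Function.update_of_ne hi] using h1 i
  rw [this, Measure.prod_prod, Measure.pi_pi]
  rw [← Finset.mul_prod_erase Finset.univ _ (Finset.mem_univ k),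
    ← Finset.mul_prod_erase Finset.univ (fun i => ν (s i)) (Finset.mem_univ k)]
  rw [Finset.prod_congr rfl (g := fun i => ν (s i))]
  · simp [mul_comm]
  · intro i hi
    rw [Function.update_of_ne (Finset.ne_of_mem_erase hi)]

theorem integrable_abs_eval_gaussian (k : K) :
    Integrable (fun g : K → ℝ => |g k|) (Measure.pi fun _ => gaussianReal 0 1) :=
  integrable_comp_eval (μ := fun _ : K => gaussianReal 0 1) (i := k) integrable_abs_gaussian

theorem integrable_eval_gaussian (k : K) :
    Integrable (fun g : K → ℝ => g k) (Measure.pi fun _ => gaussianReal 0 1) :=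
  integrable_comp_eval (μ := fun _ : K => gaussianReal 0 1) (i := k) (f := fun x => x)
    ((memLp_id_gaussianReal (μ := 0) (v := 1) 1).integrable (by simp))

theorem gaussian_integral_by_parts_pi [DecidableEq K] {F F' : (K → ℝ) → ℝ} {C : ℝ} (k : K)
    (hm : Measurable F) (hm' : Measurable F')
    (hd : ∀ g y, HasDerivAt (fun y => F (Function.update g k y)) (F' (Function.update g k y)) y)
    (hC : ∀ x, |F x| ≤ C) (hC' : ∀ x, |F' x| ≤ C) :
    ∫ g, g k * F g ∂(Measure.pi fun _ : K => gaussianReal 0 1)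
      = ∫ g, F' g ∂(Measure.pi fun _ : K => gaussianReal 0 1) := by
  have hmp := measurePreserving_pi_update (K := K) (gaussianReal 0 1) k
  have i1 : Integrable (fun g : K → ℝ => g k * F g) (Measure.pi fun _ => gaussianReal 0 1) :=
    (integrable_eval_gaussian k).mul_bdd (c := C) hm.aestronglyMeasurable (ae_of_all _ hC)
  have i2 : Integrable F' (Measure.pi fun _ : K => gaussianReal 0 1) :=
    Integrable.of_bound hm'.aestronglyMeasurable C (ae_of_all _ hC')
  have e : ∀ G : (K → ℝ) → ℝ, Integrable G (Measure.pi fun _ : K => gaussianReal 0 1) →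
      ∫ g, G g ∂(Measure.pi fun _ : K => gaussianReal 0 1)
        = ∫ g, ∫ y, G (Function.update g k y) ∂(gaussianReal 0 1)
          ∂(Measure.pi fun _ : K => gaussianReal 0 1) := by
    intro G hG
    have h1 : ∫ g, G g ∂(Measure.pi fun _ : K => gaussianReal 0 1)
        = ∫ p : (K → ℝ) × ℝ, G (Function.update p.1 k p.2)
          ∂((Measure.pi fun _ : K => gaussianReal 0 1).prod (gaussianReal 0 1)) := by
      rw [← hmp.map_eq, integral_map hmp.measurable.aemeasurable]
      · rw [hmp.map_eq]
      · rw [hmp.map_eq]; exact hG.aestronglyMeasurable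
    rw [h1]
    exact integral_prod _ (hmp.integrable_comp_of_integrable hG)
  rw [e _ i1, e _ i2]
  congr 1
  ext g
  simp only [Function.update_self]
  exact gaussian_integral_by_parts (hd g) (fun _ => hC _) (fun _ => hC' _)

end Gaussian

/-! ### Gibbs averages of bounded energies and their derivatives. -/

section Gibbs

variable {S : Type*} [MeasurableSpace S] {m : Measure S}

theorem integral_tilted_eq_div (W f : S → ℝ) :
    ∫ s, f s ∂(m.tilted W) = (∫ s, f s * Real.exp (W s) ∂m) / ∫ s, Real.exp (W s) ∂m := by
  rw [integral_tilted, ← integral_div]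
  congr 1; ext s; simp only [smul_eq_mul]; ring

variable [IsProbabilityMeasure m]

theorem integrable_mul_exp {W f : S → ℝ} {M C : ℝ} (hW : Measurable W) (hf : Measurable f)
    (hM : ∀ᵐ s ∂m, |W s| ≤ M) (hC : ∀ᵐ s ∂m, |f s| ≤ C) :
    Integrable (fun s => f s * Real.exp (W s)) m := by
  refine Integrable.of_bound (hf.mul hW.exp).aestronglyMeasurable (C * Real.exp M) ?_
  filter_upwards [hM, hC] with s h1 h2
  rw [Real.norm_eq_abs, abs_mul, Real.abs_exp]
  have := abs_le.1 h1
  exact mul_le_mul h2 (Real.exp_le_exp.2 this.2) (Real.exp_pos _).le ((abs_nonneg _).trans h2)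

theorem integrable_exp_of_bdd {W : S → ℝ} {M : ℝ} (hW : Measurable W)
    (hM : ∀ᵐ s ∂m, |W s| ≤ M) : Integrable (fun s => Real.exp (W s)) m := by
  have := integrable_mul_exp (f := fun _ => (1 : ℝ)) (C := 1) hW measurable_const hM (by simp)
  simpa using this

theorem exp_le_integral_exp {W : S → ℝ} {M : ℝ} (hW : Measurable W)
    (hM : ∀ᵐ s ∂m, |W s| ≤ M) :
    Real.exp (-M) ≤ ∫ s, Real.exp (W s) ∂m ∧ ∫ s, Real.exp (W s) ∂m ≤ Real.exp M := by
  have hi := integrable_exp_of_bdd hW hM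
  have h1 := integral_mono_ae (integrable_const (Real.exp (-M)) (μ := m)) hi
    (by filter_upwards [hM] with s hs; exact Real.exp_le_exp.2 (abs_le.1 hs).1)
  have h2 := integral_mono_ae hi (integrable_const (Real.exp M) (μ := m))
    (by filter_upwards [hM] with s hs; exact Real.exp_le_exp.2 (abs_le.1 hs).2)
  simpa using And.intro h1 h2

theorem integral_exp_pos_of_bdd {W : S → ℝ} {M : ℝ} (hW : Measurable W)
    (hM : ∀ᵐ s ∂m, |W s| ≤ M) : 0 < ∫ s, Real.exp (W s) ∂m :=
  (Real.exp_pos _).trans_le (exp_le_integral_exp hW hM).1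

theorem abs_log_integral_exp_le {W : S → ℝ} {M : ℝ} (hW : Measurable W)
    (hM : ∀ᵐ s ∂m, |W s| ≤ M) : |Real.log (∫ s, Real.exp (W s) ∂m)| ≤ M := by
  have h := exp_le_integral_exp hW hM
  have h0 := integral_exp_pos_of_bdd hW hM
  rw [abs_le]
  exact ⟨(Real.le_log_iff_exp_le h0).2 h.1, (Real.log_le_iff_le_exp h0).2 h.2⟩

theorem isProbabilityMeasure_tilted_of_bdd {W : S → ℝ} {M : ℝ} (hW : Measurable W)
    (hM : ∀ᵐ s ∂m, |W s| ≤ M) : IsProbabilityMeasure (m.tilted W) :=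
  isProbabilityMeasure_tilted (integrable_exp_of_bdd hW hM)

theorem abs_integral_tilted_le {W f : S → ℝ} {M C : ℝ} (hW : Measurable W)
    (hM : ∀ᵐ s ∂m, |W s| ≤ M) (hC : ∀ᵐ s ∂m, |f s| ≤ C) :
    |∫ s, f s ∂(m.tilted W)| ≤ C := by
  have := isProbabilityMeasure_tilted_of_bdd hW hM
  have := norm_integral_le_of_norm_le_const (μ := m.tilted W) (f := f) (C := C)
    (tilted_absolutelyContinuous m W |>.ae_le hC)
  simpa using this

theorem integrable_tilted_of_bdd {W f : S → ℝ} {M C : ℝ} (hW : Measurable W) (hf : Measurable f)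
    (hM : ∀ᵐ s ∂m, |W s| ≤ M) (hC : ∀ᵐ s ∂m, |f s| ≤ C) : Integrable f (m.tilted W) := by
  have := isProbabilityMeasure_tilted_of_bdd hW hM
  exact Integrable.of_bound hf.aestronglyMeasurable C
    (tilted_absolutelyContinuous m W |>.ae_le hC)

theorem hasDerivAt_integral_mul_exp {W W' : ℝ → S → ℝ} {f : S → ℝ} {M C : ℝ} (y₀ : ℝ)
    (hW : ∀ y, Measurable (W y)) (hW' : ∀ y, Measurable (W' y)) (hf : Measurable f)
    (hC : ∀ᵐ s ∂m, |f s| ≤ C)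
    (hM : ∀ᵐ s ∂m, ∀ y ∈ Metric.ball y₀ 1, |W y s| ≤ M)
    (hM' : ∀ᵐ s ∂m, ∀ y ∈ Metric.ball y₀ 1, |W' y s| ≤ M)
    (hd : ∀ s y, HasDerivAt (fun y => W y s) (W' y s) y) :
    HasDerivAt (fun y => ∫ s, f s * Real.exp (W y s) ∂m)
      (∫ s, f s * W' y₀ s * Real.exp (W y₀ s) ∂m) y₀ := by
  have h0 : y₀ ∈ Metric.ball y₀ 1 := Metric.mem_ball_self one_pos
  refine (hasDerivAt_integral_of_dominated_loc_of_deriv_le (μ := m)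
    (s := Metric.ball y₀ 1) (F := fun y s => f s * Real.exp (W y s))
    (F' := fun y s => f s * W' y s * Real.exp (W y s)) (bound := fun _ => C * M * Real.exp M)
    (Metric.ball_mem_nhds _ one_pos) ?_ ?_ ?_ ?_ ?_ ?_).2
  · exact Eventually.of_forall fun y => (hf.mul (hW y).exp).aestronglyMeasurable
  · exact integrable_mul_exp (hW _) hf (hM.mono fun s hs => hs _ h0) hC
  · exact ((hf.mul (hW' _)).mul (hW _).exp).aestronglyMeasurable
  · filter_upwards [hC, hM, hM'] with s h1 h2 h3 y hy
    rw [Real.norm_eq_abs, abs_mul, abs_mul, Real.abs_exp]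
    have := abs_nonneg (f s)
    have h3' := abs_nonneg (W' y s)
    gcongr
    · exact (mul_nonneg (this.trans h1) (h3'.trans (h3 y hy)))
    · exact this.trans h1
    · exact h3 y hy
    · exact (abs_le.1 (h2 y hy)).2
  · exact integrable_const _
  · filter_upwards with s y _
    exact (((hd s y).exp).const_mul (f s)).congr_deriv (by ring)

theorem hasDerivAt_log_integral_exp {W W' : ℝ → S → ℝ} {M : ℝ} (y₀ : ℝ)
    (hW : ∀ y, Measurable (W y)) (hW' : ∀ y, Measurable (W' y))
    (hM : ∀ᵐ s ∂m, ∀ y ∈ Metric.ball y₀ 1, |W y s| ≤ M)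
    (hM' : ∀ᵐ s ∂m, ∀ y ∈ Metric.ball y₀ 1, |W' y s| ≤ M)
    (hd : ∀ s y, HasDerivAt (fun y => W y s) (W' y s) y) :
    HasDerivAt (fun y => Real.log (∫ s, Real.exp (W y s) ∂m))
      (∫ s, W' y₀ s ∂(m.tilted (W y₀))) y₀ := by
  have h := hasDerivAt_integral_mul_exp (f := fun _ => (1 : ℝ)) (C := 1) y₀ hW hW'
    measurable_const (by simp) hM hM' hd
  have h0 : y₀ ∈ Metric.ball y₀ 1 := Metric.mem_ball_self one_pos
  have hp := integral_exp_pos_of_bdd (hW y₀) (hM.mono fun s hs => hs _ h0)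
  simp only [one_mul] at h
  rw [integral_tilted_eq_div]
  exact h.log hp.ne'

theorem hasDerivAt_integral_tilted {W W' : ℝ → S → ℝ} {f : S → ℝ} {M C : ℝ} (y₀ : ℝ)
    (hW : ∀ y, Measurable (W y)) (hW' : ∀ y, Measurable (W' y)) (hf : Measurable f)
    (hC : ∀ᵐ s ∂m, |f s| ≤ C)
    (hM : ∀ᵐ s ∂m, ∀ y ∈ Metric.ball y₀ 1, |W y s| ≤ M)
    (hM' : ∀ᵐ s ∂m, ∀ y ∈ Metric.ball y₀ 1, |W' y s| ≤ M)
    (hd : ∀ s y, HasDerivAt (fun y => W y s) (W' y s) y) :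
    HasDerivAt (fun y => ∫ s, f s ∂(m.tilted (W y)))
      (∫ s, f s * W' y₀ s ∂(m.tilted (W y₀))
        - (∫ s, f s ∂(m.tilted (W y₀))) * ∫ s, W' y₀ s ∂(m.tilted (W y₀))) y₀ := by
  have h1 := hasDerivAt_integral_mul_exp (f := fun _ => (1 : ℝ)) (C := 1) y₀ hW hW'
    measurable_const (by simp) hM hM' hd
  have h2 := hasDerivAt_integral_mul_exp y₀ hW hW' hf hC hM hM' hd
  have h0 : y₀ ∈ Metric.ball y₀ 1 := Metric.mem_ball_self one_pos
  have hp := integral_exp_pos_of_bdd (hW y₀) (hM.mono fun s hs => hs _ h0)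
  simp only [one_mul] at h1
  simp only [integral_tilted_eq_div]
  exact (h2.div h1 hp.ne').congr_deriv (by field_simp)

/-- Independent replicas: the tilt of a product measure by a sum of energies factorises. Squares of
Gibbs averages thereby become two-replica averages. -/
theorem integral_tilted_mul_integral_tilted {S' : Type*} [MeasurableSpace S'] {m' : Measure S'}
    [IsProbabilityMeasure m'] (W f : S → ℝ) (W' f' : S' → ℝ) :
    (∫ s, f s ∂(m.tilted W)) * ∫ s, f' s ∂(m'.tilted W') =
      ∫ p, f p.1 * f' p.2 ∂((m.prod m').tilted fun p => W p.1 + W' p.2) := by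
  simp only [integral_tilted_eq_div, Real.exp_add]
  rw [integral_prod_mul (fun s => Real.exp (W s)) (fun s => Real.exp (W' s)), div_mul_div_comm,
    ← integral_prod_mul]
  congr 2
  ext p; ring

theorem measurable_integral_tilted {X : Type*} [MeasurableSpace X] {W f : X → S → ℝ}
    (hW : Measurable (Function.uncurry W)) (hf : Measurable (Function.uncurry f)) :
    Measurable fun x => ∫ s, f x s ∂(m.tilted (W x)) := by
  simp only [integral_tilted_eq_div]
  refine Measurable.div ?_ ?_
  · exact ((hf.mul hW.exp).stronglyMeasurable.integral_prod_right' (ν := m)).measurable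
  · exact (hW.exp.stronglyMeasurable.integral_prod_right' (ν := m)).measurable

theorem measurable_log_integral_exp {X : Type*} [MeasurableSpace X] {W : X → S → ℝ}
    (hW : Measurable (Function.uncurry W)) :
    Measurable fun x => Real.log (∫ s, Real.exp (W x s) ∂m) :=
  (hW.exp.stronglyMeasurable.integral_prod_right' (ν := m)).measurable.log

end Gibbs

end GeneralSpinSK

/-! ### Differentiation of the expected log-partition function along a general path. -/

namespace GeneralSpinSK

/-- A family of random energies `∑ₖ gₖ cₖ(θ) fₖ(s) + b(θ, s)` on a probability space `(S, m)`, with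
standard Gaussian `gₖ`, differentiable in the parameter `θ` and uniformly bounded for `m`-almost all
`s`. -/
structure EnergyPath (K : Type*) {S : Type*} [MeasurableSpace S] (m : Measure S) where
  /-- the coefficients of the Gaussian variables -/
  c : K → ℝ → ℝ
  /-- the derivatives of the coefficients -/
  c' : K → ℝ → ℝ
  /-- the features -/
  f : K → S → ℝ
  /-- the deterministic part -/
  b : ℝ → S → ℝ
  /-- the derivative of the deterministic part -/
  b' : ℝ → S → ℝ
  /-- a common bound -/
  C : ℝ
  C_nonneg : 0 ≤ C
  hasDerivAt_c : ∀ k θ, HasDerivAt (c k) (c' k θ) θ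
  abs_c_le : ∀ k θ, |c k θ| ≤ C
  abs_c'_le : ∀ k θ, |c' k θ| ≤ C
  measurable_f : ∀ k, Measurable (f k)
  abs_f_le : ∀ᵐ s ∂m, ∀ k, |f k s| ≤ C
  measurable_b : ∀ θ, Measurable (b θ)
  measurable_b' : ∀ θ, Measurable (b' θ)
  hasDerivAt_b : ∀ s θ, HasDerivAt (fun θ => b θ s) (b' θ s) θ
  abs_b_le : ∀ᵐ s ∂m, ∀ θ, |b θ s| ≤ C
  abs_b'_le : ∀ᵐ s ∂m, ∀ θ, |b' θ s| ≤ C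

namespace EnergyPath

variable {K : Type*} {S : Type*} [MeasurableSpace S] {m : Measure S} (P : EnergyPath K m)

theorem abs_f_le' (k : K) : ∀ᵐ s ∂m, |P.f k s| ≤ P.C := P.abs_f_le.mono fun _ h => h k

theorem abs_f_sq_le (k : K) : ∀ᵐ s ∂m, |P.f k s ^ 2| ≤ P.C ^ 2 :=
  P.abs_f_le.mono fun _ h => by
    rw [abs_pow]
    exact pow_le_pow_left₀ (abs_nonneg _) (h k) 2

variable [Fintype K]

/-- The random energy. -/
def energy (θ : ℝ) (g : K → ℝ) (s : S) : ℝ := ∑ k, g k * P.c k θ * P.f k s + P.b θ s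

/-- The derivative of the random energy. -/
def energy' (θ : ℝ) (g : K → ℝ) (s : S) : ℝ := ∑ k, g k * P.c' k θ * P.f k s + P.b' θ s

/-- A bound on the energy and its derivative. -/
def bound (g : K → ℝ) : ℝ := ∑ k, |g k| * P.C * P.C + P.C

/-- The expected log-partition function. -/
noncomputable def logZ (θ : ℝ) : ℝ :=
  ∫ g, Real.log (∫ s, Real.exp (P.energy θ g s) ∂m) ∂(Measure.pi fun _ : K => gaussianReal 0 1)

theorem abs_energy_le : ∀ᵐ s ∂m, ∀ θ g, |P.energy θ g s| ≤ P.bound g := by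
  filter_upwards [P.abs_f_le, P.abs_b_le] with s hf hb θ g
  refine (abs_add_le _ _).trans (add_le_add ((Finset.abs_sum_le_sum_abs _ _).trans
    (Finset.sum_le_sum fun k _ => ?_)) (hb θ))
  rw [abs_mul, abs_mul]
  have := P.C_nonneg
  gcongr
  exacts [P.abs_c_le k θ, hf k]

theorem abs_energy'_le : ∀ᵐ s ∂m, ∀ θ g, |P.energy' θ g s| ≤ P.bound g := by
  filter_upwards [P.abs_f_le, P.abs_b'_le] with s hf hb θ g
  refine (abs_add_le _ _).trans (add_le_add ((Finset.abs_sum_le_sum_abs _ _).trans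
    (Finset.sum_le_sum fun k _ => ?_)) (hb θ))
  rw [abs_mul, abs_mul]
  have := P.C_nonneg
  gcongr
  exacts [P.abs_c'_le k θ, hf k]

theorem measurable_energy_uncurry (θ : ℝ) : Measurable (Function.uncurry (P.energy θ)) := by
  have h1 := P.measurable_f
  have h2 := P.measurable_b θ
  unfold energy Function.uncurry
  fun_prop

theorem measurable_energy'_uncurry (θ : ℝ) : Measurable (Function.uncurry (P.energy' θ)) := by
  have h1 := P.measurable_f
  have h2 := P.measurable_b' θ
  unfold energy' Function.uncurry
  fun_prop

theorem measurable_energy (θ : ℝ) (g : K → ℝ) : Measurable (P.energy θ g) :=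
  (P.measurable_energy_uncurry θ).comp measurable_prodMk_left

theorem measurable_energy' (θ : ℝ) (g : K → ℝ) : Measurable (P.energy' θ g) :=
  (P.measurable_energy'_uncurry θ).comp measurable_prodMk_left

theorem abs_energy_le' (θ : ℝ) (g : K → ℝ) : ∀ᵐ s ∂m, |P.energy θ g s| ≤ P.bound g :=
  P.abs_energy_le.mono fun _ h => h θ g

theorem abs_energy'_le' (θ : ℝ) (g : K → ℝ) : ∀ᵐ s ∂m, |P.energy' θ g s| ≤ P.bound g :=
  P.abs_energy'_le.mono fun _ h => h θ g

theorem integrable_bound :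
    Integrable P.bound (Measure.pi fun _ : K => gaussianReal 0 1) := by
  unfold bound
  exact (integrable_finsetSum _ fun k _ =>
    ((integrable_abs_eval_gaussian k).mul_const _).mul_const _).add (integrable_const _)

theorem hasDerivAt_energy (θ : ℝ) (g : K → ℝ) (s : S) :
    HasDerivAt (fun θ => P.energy θ g s) (P.energy' θ g s) θ := by
  unfold energy energy'
  exact (HasDerivAt.fun_sum fun k _ =>
    ((P.hasDerivAt_c k θ).const_mul _).mul_const _).add (P.hasDerivAt_b s θ)

variable [IsProbabilityMeasure m]

theorem integrable_log (θ : ℝ) :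
    Integrable (fun g => Real.log (∫ s, Real.exp (P.energy θ g s) ∂m))
      (Measure.pi fun _ : K => gaussianReal 0 1) :=
  P.integrable_bound.mono'
    (measurable_log_integral_exp (P.measurable_energy_uncurry θ)).aestronglyMeasurable
    (ae_of_all _ fun g => abs_log_integral_exp_le (P.measurable_energy θ g) (P.abs_energy_le' θ g))

theorem measurable_gibbs (θ : ℝ) {F : S → ℝ} (hF : Measurable F) :
    Measurable fun g => ∫ s, F s ∂(m.tilted (P.energy θ g)) :=
  measurable_integral_tilted (f := fun _ => F) (P.measurable_energy_uncurry θ)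
    (hF.comp measurable_snd)

theorem abs_gibbs_le (θ : ℝ) (g : K → ℝ) {F : S → ℝ} {C : ℝ} (hC : ∀ᵐ s ∂m, |F s| ≤ C) :
    |∫ s, F s ∂(m.tilted (P.energy θ g))| ≤ C :=
  abs_integral_tilted_le (P.measurable_energy θ g) (P.abs_energy_le' θ g) hC

theorem integrable_tilted (θ : ℝ) (g : K → ℝ) {F : S → ℝ} {C : ℝ} (hF : Measurable F)
    (hC : ∀ᵐ s ∂m, |F s| ≤ C) : Integrable F (m.tilted (P.energy θ g)) :=
  integrable_tilted_of_bdd (P.measurable_energy θ g) hF (P.abs_energy_le' θ g) hC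

theorem integrable_gibbs (θ : ℝ) {F : S → ℝ} {C : ℝ} (hF : Measurable F)
    (hC : ∀ᵐ s ∂m, |F s| ≤ C) :
    Integrable (fun g => ∫ s, F s ∂(m.tilted (P.energy θ g)))
      (Measure.pi fun _ : K => gaussianReal 0 1) :=
  Integrable.of_bound (P.measurable_gibbs θ hF).aestronglyMeasurable C
    (ae_of_all _ fun g => P.abs_gibbs_le θ g hC)

/-- The energy is affine in each Gaussian variable, so the response of a Gibbs mean is a covariance,
here `c k θ` times the variance of `f k`. -/
theorem hasDerivAt_gibbs_update [DecidableEq K] (θ : ℝ) (k : K) (g : K → ℝ) (y : ℝ) :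
    HasDerivAt (fun y => ∫ s, P.f k s ∂(m.tilted (P.energy θ (Function.update g k y))))
      (P.c k θ * (∫ s, P.f k s ^ 2 ∂(m.tilted (P.energy θ (Function.update g k y)))
        - (∫ s, P.f k s ∂(m.tilted (P.energy θ (Function.update g k y)))) ^ 2)) y := by
  -- For `y'` within distance one of `y` the coordinate `k` is at most `|y| + 1` in absolute value;
  -- the extra `C * C` dominates the derivative of the energy.
  have h := hasDerivAt_integral_tilted (m := m)
    (W := fun y => P.energy θ (Function.update g k y))
    (W' := fun y s => P.c k θ * P.f k s) (f := P.f k)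
    (M := P.bound (Function.update g k (|y| + 1)) + P.C * P.C) (C := P.C) y
    (fun y => P.measurable_energy θ _) (fun y => (P.measurable_f k).const_mul _) (P.measurable_f k)
    (P.abs_f_le' k) ?_ ?_ ?_
  · refine h.congr_deriv ?_
    have e : ∀ s, P.f k s * (P.c k θ * P.f k s) = P.c k θ * P.f k s ^ 2 := fun s => by ring
    simp only [e, integral_const_mul]
    ring
  · filter_upwards [P.abs_energy_le] with s hs z hz
    refine (hs θ _).trans ?_
    have hC := P.C_nonneg
    refine le_add_of_le_of_nonneg ?_ (by positivity)
    unfold bound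
    refine add_le_add_left (Finset.sum_le_sum fun j _ => ?_) _
    gcongr ?_ * _ * _
    by_cases hj : j = k
    · subst hj
      simp only [Function.update_self]
      rw [Metric.mem_ball, Real.dist_eq] at hz
      rw [abs_of_nonneg (a := |y| + 1) (by positivity)]
      have := abs_sub_abs_le_abs_sub z y
      linarith
    · simp [Function.update_of_ne hj]
  · filter_upwards [P.abs_f_le] with s hs z _
    have hC := P.C_nonneg
    rw [abs_mul]
    refine le_add_of_nonneg_of_le ?_
      (mul_le_mul (P.abs_c_le k θ) (hs k) (abs_nonneg _) hC)
    unfold bound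
    positivity
  · intro s z
    unfold energy
    have : ∀ j, HasDerivAt (fun y => Function.update g k y j * P.c j θ * P.f j s)
        (if j = k then P.c k θ * P.f k s else 0) z := by
      intro j
      by_cases hj : j = k
      · subst hj
        simp only [Function.update_self, if_true]
        exact (((hasDerivAt_id z).mul_const _).mul_const _).congr_deriv (by ring)
      · simp only [Function.update_of_ne hj, if_neg hj]
        exact hasDerivAt_const _ _
    exact ((HasDerivAt.fun_sum fun j _ => this j).add_const _).congr_deriv (by simp)

theorem integral_mul_gibbs (θ : ℝ) (k : K) :
    ∫ g, g k * ∫ s, P.f k s ∂(m.tilted (P.energy θ g)) ∂(Measure.pi fun _ : K => gaussianReal 0 1)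
      = ∫ g, P.c k θ * (∫ s, P.f k s ^ 2 ∂(m.tilted (P.energy θ g))
        - (∫ s, P.f k s ∂(m.tilted (P.energy θ g))) ^ 2)
        ∂(Measure.pi fun _ : K => gaussianReal 0 1) := by
  classical
  have hC := P.C_nonneg
  refine gaussian_integral_by_parts_pi (C := P.C + P.C * (P.C ^ 2 + P.C ^ 2)) k
    (P.measurable_gibbs θ (P.measurable_f k)) ?_ (P.hasDerivAt_gibbs_update θ k) ?_ ?_
  · exact ((P.measurable_gibbs θ ((P.measurable_f k).pow_const 2)).sub
      ((P.measurable_gibbs θ (P.measurable_f k)).pow_const 2)).const_mul _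
  · exact fun g => (P.abs_gibbs_le θ g (P.abs_f_le' k)).trans (le_add_of_nonneg_right (by positivity))
  · intro g
    refine le_add_of_nonneg_of_le hC ?_
    rw [abs_mul]
    refine mul_le_mul (P.abs_c_le k θ) ((abs_sub _ _).trans (add_le_add
      (P.abs_gibbs_le θ g (P.abs_f_sq_le k)) ?_)) (abs_nonneg _) hC
    rw [abs_pow]
    exact pow_le_pow_left₀ (abs_nonneg _) (P.abs_gibbs_le θ g (P.abs_f_le' k)) 2

/-- The derivative of the expected log-partition function along the path. -/
theorem hasDerivAt_logZ (θ : ℝ) :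
    HasDerivAt P.logZ
      (∫ g, (∫ s, P.b' θ s + ∑ k, P.c k θ * P.c' k θ * P.f k s ^ 2 ∂(m.tilted (P.energy θ g)))
        - ∑ k, P.c k θ * P.c' k θ * (∫ s, P.f k s ∂(m.tilted (P.energy θ g))) ^ 2
        ∂(Measure.pi fun _ : K => gaussianReal 0 1)) θ := by
  have h := (hasDerivAt_integral_of_dominated_loc_of_deriv_le
    (μ := Measure.pi fun _ : K => gaussianReal 0 1) (s := Set.univ) (x₀ := θ)
    (F := fun θ g => Real.log (∫ s, Real.exp (P.energy θ g s) ∂m))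
    (F' := fun θ g => ∫ s, P.energy' θ g s ∂(m.tilted (P.energy θ g))) (bound := P.bound)
    Filter.univ_mem
    (Eventually.of_forall fun y =>
      (measurable_log_integral_exp (P.measurable_energy_uncurry y)).aestronglyMeasurable)
    (P.integrable_log θ)
    (measurable_integral_tilted (P.measurable_energy_uncurry θ)
      (P.measurable_energy'_uncurry θ)).aestronglyMeasurable
    (ae_of_all _ fun g y _ => abs_integral_tilted_le (P.measurable_energy y g)
      (P.abs_energy_le' y g) (P.abs_energy'_le' y g))
    P.integrable_bound
    (ae_of_all _ fun g y _ => hasDerivAt_log_integral_exp (M := P.bound g) y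
      (fun y => P.measurable_energy y g)
      (fun y => P.measurable_energy' y g)
      (P.abs_energy_le.mono fun s hs z _ => hs z g)
      (P.abs_energy'_le.mono fun s hs z _ => hs z g)
      (fun s z => P.hasDerivAt_energy z g s))).2
  -- The derivative is the Gibbs average of `energy'`, which is linear in `g`. Integration by parts
  -- replaces each factor `g k` by `c k θ` times the variance of `f k`.
  refine h.congr_deriv ?_
  have if2 : ∀ g k, Integrable (fun s => P.f k s ^ 2) (m.tilted (P.energy θ g)) := fun g k =>
    P.integrable_tilted θ g ((P.measurable_f k).pow_const 2) (P.abs_f_sq_le k)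
  have if1 : ∀ g k, Integrable (P.f k) (m.tilted (P.energy θ g)) := fun g k =>
    P.integrable_tilted θ g (P.measurable_f k) (P.abs_f_le' k)
  have ib : ∀ g, Integrable (P.b' θ) (m.tilted (P.energy θ g)) := fun g =>
    P.integrable_tilted θ g (P.measurable_b' θ) (P.abs_b'_le.mono fun s hs => hs θ)
  have e1 : ∀ g, ∫ s, P.energy' θ g s ∂(m.tilted (P.energy θ g))
      = ∑ k, P.c' k θ * (g k * ∫ s, P.f k s ∂(m.tilted (P.energy θ g)))
        + ∫ s, P.b' θ s ∂(m.tilted (P.energy θ g)) := by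
    intro g
    unfold energy'
    rw [integral_add (integrable_finsetSum _ fun k _ => (if1 g k).const_mul _) (ib g),
      integral_finsetSum _ fun k _ => (if1 g k).const_mul _]
    congr 1
    refine Finset.sum_congr rfl fun k _ => ?_
    rw [integral_const_mul]; ring
  have e2 : ∀ g, (∫ s, P.b' θ s + ∑ k, P.c k θ * P.c' k θ * P.f k s ^ 2
        ∂(m.tilted (P.energy θ g)))
        - ∑ k, P.c k θ * P.c' k θ * (∫ s, P.f k s ∂(m.tilted (P.energy θ g))) ^ 2
      = ∑ k, P.c' k θ * (P.c k θ * (∫ s, P.f k s ^ 2 ∂(m.tilted (P.energy θ g))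
        - (∫ s, P.f k s ∂(m.tilted (P.energy θ g))) ^ 2))
        + ∫ s, P.b' θ s ∂(m.tilted (P.energy θ g)) := by
    intro g
    rw [integral_add (ib g) (integrable_finsetSum _ fun k _ => (if2 g k).const_mul _),
      integral_finsetSum _ fun k _ => (if2 g k).const_mul _, add_sub_assoc, add_comm,
      ← Finset.sum_sub_distrib]
    congr 1
    refine Finset.sum_congr rfl fun k _ => ?_
    rw [integral_const_mul]; ring
  simp only [e1, e2]
  have j0 : Integrable (fun g => ∫ s, P.b' θ s ∂(m.tilted (P.energy θ g)))
      (Measure.pi fun _ : K => gaussianReal 0 1) :=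
    P.integrable_gibbs θ (P.measurable_b' θ) (P.abs_b'_le.mono fun s hs => hs θ)
  have j1 : ∀ k, Integrable (fun g => g k * ∫ s, P.f k s ∂(m.tilted (P.energy θ g)))
      (Measure.pi fun _ : K => gaussianReal 0 1) := fun k =>
    (integrable_eval_gaussian k).mul_bdd (c := P.C)
      (P.measurable_gibbs θ (P.measurable_f k)).aestronglyMeasurable
      (ae_of_all _ fun g => P.abs_gibbs_le θ g (P.abs_f_le' k))
  have j2 : ∀ k, Integrable (fun g => P.c k θ * (∫ s, P.f k s ^ 2 ∂(m.tilted (P.energy θ g))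
        - (∫ s, P.f k s ∂(m.tilted (P.energy θ g))) ^ 2))
      (Measure.pi fun _ : K => gaussianReal 0 1) := fun k =>
    ((P.integrable_gibbs θ ((P.measurable_f k).pow_const 2) (P.abs_f_sq_le k)).sub
      (Integrable.of_bound ((P.measurable_gibbs θ
        (P.measurable_f k)).pow_const 2).aestronglyMeasurable (P.C ^ 2) (ae_of_all _ fun g => by
          rw [Real.norm_eq_abs, abs_pow]
          exact pow_le_pow_left₀ (abs_nonneg _) (P.abs_gibbs_le θ g (P.abs_f_le' k)) 2))).const_mul _
  rw [integral_add (integrable_finsetSum _ fun k _ => (j1 k).const_mul _) j0,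
    integral_finsetSum _ fun k _ => (j1 k).const_mul _,
    integral_add (integrable_finsetSum _ fun k _ => (j2 k).const_mul _) j0,
    integral_finsetSum _ fun k _ => (j2 k).const_mul _]
  congr 1
  refine Finset.sum_congr rfl fun k _ => ?_
  rw [integral_const_mul, integral_const_mul, P.integral_mul_gibbs θ k]

end EnergyPath

end GeneralSpinSK

namespace GeneralSpinSK

/-! ### The Hamiltonian as a Gaussian field with covariance given by the overlap. -/

section Overlap

variable {n : ℕ}

/-- The features of a spin configuration coupled to the Gaussian disorder: the entries of the
Hamiltonian and the spins themselves. -/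
noncomputable def feature (k : (Fin n × Fin n) ⊕ Fin n) (σ : Fin n → ℝ) : ℝ :=
  Sum.elim (fun p : Fin n × Fin n =>
    if p.1 < p.2 then √(2 / (n : ℝ)) * (σ p.1 * σ p.2)
    else if p.1 = p.2 then 1 / √(n : ℝ) * σ p.1 ^ 2 else 0) (fun i => σ i) k

theorem measurable_feature (k : (Fin n × Fin n) ⊕ Fin n) : Measurable (feature k) := by
  unfold feature
  rcases k with p | i
  · simp only [Sum.elim_inl]
    split_ifs <;> fun_prop
  · simp only [Sum.elim_inr]; fun_prop

theorem abs_feature_le (k : (Fin n × Fin n) ⊕ Fin n) {σ : Fin n → ℝ} (hσ : ∀ i, |σ i| ≤ 1) :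
    |feature k σ| ≤ 2 := by
  unfold feature
  rcases k with p | i
  · have hn : p.1 = p.1 → (1 : ℝ) ≤ n := fun _ => by
      exact_mod_cast (Nat.succ_le_of_lt (Fin.pos p.1))
    have hn := hn rfl
    simp only [Sum.elim_inl]
    split_ifs
    · rw [abs_mul, abs_mul, abs_of_nonneg (Real.sqrt_nonneg _)]
      have h1 : √(2 / (n : ℝ)) ≤ 2 := by
        rw [Real.sqrt_le_left (by norm_num), div_le_iff₀ (by positivity)]
        linarith
      calc √(2 / (n : ℝ)) * (|σ p.1| * |σ p.2|) ≤ 2 * (1 * 1) := by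
            gcongr
            exacts [hσ _, hσ _]
        _ = 2 := by norm_num
    · rw [abs_mul, abs_pow, abs_of_nonneg (by positivity)]
      have h1 : 1 / √(n : ℝ) ≤ 1 := by
        rw [div_le_one (by positivity)]
        exact Real.one_le_sqrt.2 hn
      calc _ ≤ (1 : ℝ) * 1 ^ 2 := by
            gcongr
            exact hσ _
        _ ≤ 2 := by norm_num
    · simp
  · simpa using (hσ i).trans one_le_two

theorem sum_feature_eq_hamiltonian (g : Fin n × Fin n → ℝ) (σ : Fin n → ℝ) :
    ∑ p, g p * feature (Sum.inl p) σ = hamiltonian g σ := by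
  unfold hamiltonian feature
  simp only [Sum.elim_inl, Finset.mul_sum, Finset.sum_filter]
  have h2 : ∑ i, 1 / √(n : ℝ) * (g (i, i) * σ i ^ 2)
      = ∑ p : Fin n × Fin n, if p.1 = p.2 then 1 / √(n : ℝ) * (g p * σ p.1 ^ 2) else 0 := by
    rw [Fintype.sum_prod_type]
    simp
  rw [h2, ← Finset.sum_add_distrib]
  refine Finset.sum_congr rfl fun p _ => ?_
  by_cases h : p.1 < p.2
  · simp only [h, h.ne, if_true, if_false]; ring
  · by_cases h' : p.1 = p.2
    · simp only [h', if_true, if_false, lt_irrefl]; ring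
    · simp [h, h']

theorem sum_filter_lt_eq (x : Fin n → ℝ) :
    2 * (∑ p : Fin n × Fin n, if p.1 < p.2 then x p.1 * x p.2 else 0) + ∑ i, x i ^ 2
      = (∑ i, x i) ^ 2 := by
  have h1 : (∑ p : Fin n × Fin n, if p.1 < p.2 then x p.1 * x p.2 else 0)
      = ∑ p : Fin n × Fin n, if p.2 < p.1 then x p.1 * x p.2 else 0 := by
    rw [← Equiv.sum_comp (Equiv.prodComm _ _)]
    exact Finset.sum_congr rfl fun p _ => by simp [mul_comm]
  have h2 : ∑ i, x i ^ 2 = ∑ p : Fin n × Fin n, if p.1 = p.2 then x p.1 * x p.2 else 0 := by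
    rw [Fintype.sum_prod_type]; simp [sq]
  rw [two_mul]
  nth_rewrite 2 [h1]
  rw [h2, ← Finset.sum_add_distrib, ← Finset.sum_add_distrib, sq, Finset.sum_mul_sum,
    ← Fintype.sum_prod_type']
  refine Finset.sum_congr rfl fun p _ => ?_
  rcases lt_trichotomy p.1 p.2 with h | h | h
  · simp [h, h.ne, h.not_gt]
  · simp [h]
  · simp [h, h.ne', h.not_gt]

/-- The weights `√(2/n)` off the diagonal and `1/√n` on it are exactly those making the covariance
of the Hamiltonian a perfect square in the overlap. -/
theorem sum_feature_inl_mul (σ τ : Fin n → ℝ) :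
    ∑ p, feature (Sum.inl p) σ * feature (Sum.inl p) τ = n * overlap σ τ ^ 2 := by
  rcases Nat.eq_zero_or_pos n with rfl | hn
  · simp
  have hn' : (0 : ℝ) < n := by exact_mod_cast hn
  have h := sum_filter_lt_eq (fun i => σ i * τ i)
  have h2 : ∑ i, (σ i * τ i) ^ 2
      = ∑ p : Fin n × Fin n, if p.1 = p.2 then (σ p.1 * τ p.1) ^ 2 else 0 := by
    rw [Fintype.sum_prod_type]; simp
  unfold overlap
  rw [mul_pow, ← h, h2, Finset.mul_sum, ← Finset.sum_add_distrib, Finset.mul_sum, Finset.mul_sum]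
  refine Finset.sum_congr rfl fun p _ => ?_
  have e1 : √(2 / (n : ℝ)) * √(2 / (n : ℝ)) = 2 / n := Real.mul_self_sqrt (by positivity)
  have e2 : √(n : ℝ) ^ 2 = n := Real.sq_sqrt hn'.le
  unfold feature
  simp only [Sum.elim_inl]
  by_cases h : p.1 < p.2
  · simp only [h, h.ne, if_true, if_false]
    rw [show √(2 / (n : ℝ)) * (σ p.1 * σ p.2) * (√(2 / (n : ℝ)) * (τ p.1 * τ p.2))
      = (√(2 / (n : ℝ)) * √(2 / (n : ℝ))) * (σ p.1 * σ p.2 * (τ p.1 * τ p.2)) by ring, e1]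
    field_simp
    ring
  · by_cases h' : p.1 = p.2
    · simp only [h', if_true, if_false, lt_irrefl]
      rw [show 1 / √(n : ℝ) * σ p.2 ^ 2 * (1 / √(n : ℝ) * τ p.2 ^ 2)
        = 1 / (√(n : ℝ) ^ 2) * (σ p.2 ^ 2 * τ p.2 ^ 2) by ring, e2]
      field_simp
      ring
    · simp [h, h']

theorem sum_feature_inr_mul (σ τ : Fin n → ℝ) :
    ∑ i, feature (Sum.inr i) σ * feature (Sum.inr i) τ = n * overlap σ τ := by
  rcases Nat.eq_zero_or_pos n with rfl | hn
  · simp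
  have hn' : (n : ℝ) ≠ 0 := by exact_mod_cast hn.ne'
  unfold overlap feature
  simp only [Sum.elim_inr]
  field_simp

theorem abs_overlap_le {σ τ : Fin n → ℝ} (hσ : ∀ i, |σ i| ≤ 1) (hτ : ∀ i, |τ i| ≤ 1) :
    |overlap σ τ| ≤ 1 := by
  unfold overlap
  rw [abs_mul, abs_of_nonneg (by positivity)]
  have : |∑ i, σ i * τ i| ≤ n := by
    refine (Finset.abs_sum_le_sum_abs _ _).trans ?_
    calc ∑ i, |σ i * τ i| ≤ ∑ _i : Fin n, (1 : ℝ) := Finset.sum_le_sum fun i _ => by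
          rw [abs_mul]; exact mul_le_one₀ (hσ i) (abs_nonneg _) (hτ i)
      _ = n := by simp
  calc _ ≤ 1 / (n : ℝ) * n := by gcongr
    _ ≤ 1 := by
      rw [one_div]; exact inv_mul_le_one

@[fun_prop]
theorem measurable_overlap {X : Type*} [MeasurableSpace X] {a b : X → Fin n → ℝ}
    (ha : Measurable a) (hb : Measurable b) : Measurable fun x => overlap (a x) (b x) := by
  unfold overlap
  fun_prop

theorem ae_abs_le_one {μ : Measure ℝ} [IsProbabilityMeasure μ]
    (hμ : ∀ᵐ s ∂μ, s ∈ Set.Icc (-1 : ℝ) 1) :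
    ∀ᵐ σ ∂(Measure.pi fun _ : Fin n => μ), ∀ i, |σ i| ≤ 1 := by
  rw [eventually_countable_forall]
  intro i
  have := (measurePreserving_eval (fun _ : Fin n => μ) i).quasiMeasurePreserving.ae hμ
  filter_upwards [this] with σ hσ
  exact abs_le.2 hσ

theorem ae_abs_le_one_prod {μ : Measure ℝ} [IsProbabilityMeasure μ]
    (hμ : ∀ᵐ s ∂μ, s ∈ Set.Icc (-1 : ℝ) 1) :
    ∀ᵐ p ∂((Measure.pi fun _ : Fin n => μ).prod (Measure.pi fun _ : Fin n => μ)),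
      (∀ i, |p.1 i| ≤ 1) ∧ ∀ i, |p.2 i| ≤ 1 :=
  (Measure.quasiMeasurePreserving_fst.ae (ae_abs_le_one hμ)).and
    (Measure.quasiMeasurePreserving_snd.ae (ae_abs_le_one hμ))

end Overlap

/-! ### The interpolating paths for one and two replicas. -/

section Paths

/-- The coefficients of the path from decoupled spins in a Gaussian field to the SK model. -/
noncomputable def pathCoef {n : ℕ} (t q : ℝ) (k : (Fin n × Fin n) ⊕ Fin n) (θ : ℝ) : ℝ :=
  Sum.elim (fun _ => √t * Real.sin θ) (fun _ => √(2 * q * t) * Real.cos θ) k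

/-- The derivative of `pathCoef`. -/
noncomputable def pathCoef' {n : ℕ} (t q : ℝ) (k : (Fin n × Fin n) ⊕ Fin n) (θ : ℝ) : ℝ :=
  Sum.elim (fun _ => √t * Real.cos θ) (fun _ => √(2 * q * t) * -Real.sin θ) k

/-- Half the `θ`-derivative of the covariance of the Gaussian part. The disorder contributes `tR²`
and the site fields `-2qtR`; the choice `2qt` of field variance completes the square around `q`. -/
theorem sum_pathCoef_mul {n : ℕ} {t q : ℝ} (ht : 0 ≤ t) (hq : 0 ≤ q) (θ : ℝ) (σ τ : Fin n → ℝ) :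
    ∑ k, pathCoef t q k θ * pathCoef' t q k θ * (feature k σ * feature k τ)
      = n * t * (Real.sin θ * Real.cos θ) * ((overlap σ τ - q) ^ 2 - q ^ 2) := by
  have e1 : √t * √t = t := Real.mul_self_sqrt ht
  have e2 : √(2 * q * t) * √(2 * q * t) = 2 * q * t := Real.mul_self_sqrt (by positivity)
  rw [Fintype.sum_sum_type]
  simp only [pathCoef, pathCoef', Sum.elim_inl, Sum.elim_inr, ← Finset.mul_sum]
  rw [sum_feature_inl_mul, sum_feature_inr_mul,
    show √t * Real.sin θ * (√t * Real.cos θ) = (√t * √t) * (Real.sin θ * Real.cos θ) by ring,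
    show √(2 * q * t) * Real.cos θ * (√(2 * q * t) * -Real.sin θ)
      = -((√(2 * q * t) * √(2 * q * t)) * (Real.sin θ * Real.cos θ)) by ring, e1, e2]
  ring

variable {n : ℕ} (h : ℝ) {t q : ℝ}

theorem hasDerivAt_sin_sq (θ : ℝ) :
    HasDerivAt (fun θ => Real.sin θ ^ 2) (2 * (Real.sin θ * Real.cos θ)) θ :=
  ((Real.hasDerivAt_sin θ).pow 2).congr_deriv (by simp; ring)

theorem hasDerivAt_cos_sq (θ : ℝ) :
    HasDerivAt (fun θ => Real.cos θ ^ 2) (-(2 * (Real.sin θ * Real.cos θ))) θ :=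
  ((Real.hasDerivAt_cos θ).pow 2).congr_deriv (by simp; ring)

theorem abs_sin_mul_cos_le (θ : ℝ) : |Real.sin θ * Real.cos θ| ≤ 1 := by
  rw [abs_mul]
  exact mul_le_one₀ (Real.abs_sin_le_one θ) (abs_nonneg _) (Real.abs_cos_le_one θ)

/-- The deterministic part of the single-replica energy. -/
noncomputable def drift (h t q θ : ℝ) (σ : Fin n → ℝ) : ℝ :=
  h * ∑ i, σ i - t / 2 * n * overlap σ σ ^ 2 * Real.sin θ ^ 2
    - q * t * n * overlap σ σ * Real.cos θ ^ 2

/-- The derivative of `drift` in `θ`. -/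
noncomputable def drift' (t q θ : ℝ) (σ : Fin n → ℝ) : ℝ :=
  -(n * t * (Real.sin θ * Real.cos θ) * ((overlap σ σ - q) ^ 2 - q ^ 2))

theorem hasDerivAt_drift (σ : Fin n → ℝ) (θ : ℝ) :
    HasDerivAt (fun θ => drift h t q θ σ) (drift' t q θ σ) θ := by
  unfold drift drift'
  exact ((((hasDerivAt_sin_sq θ).const_mul _).const_sub _).sub
    ((hasDerivAt_cos_sq θ).const_mul _)).congr_deriv (by ring)

/-- A bound for the ingredients of the single-replica energy. -/
noncomputable def pathBound (n : ℕ) (h t q : ℝ) : ℝ :=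
  2 + √t + √(2 * q * t) + n * |h| + n * t * (1 + 2 * q)

theorem two_le_pathBound (ht : 0 ≤ t) (hq : 0 ≤ q) : 2 ≤ pathBound n h t q := by
  unfold pathBound
  have := Real.sqrt_nonneg t
  have := Real.sqrt_nonneg (2 * q * t)
  have : 0 ≤ n * |h| := by positivity
  have : 0 ≤ n * t * (1 + 2 * q) := by positivity
  linarith

theorem abs_pathCoef_le (ht : 0 ≤ t) (hq : 0 ≤ q) (k : (Fin n × Fin n) ⊕ Fin n) (θ : ℝ) :
    |pathCoef t q k θ| ≤ pathBound n h t q ∧ |pathCoef' t q k θ| ≤ pathBound n h t q := by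
  have h1 := Real.sqrt_nonneg t
  have h2 := Real.sqrt_nonneg (2 * q * t)
  have h3 : 0 ≤ n * |h| := by positivity
  have h4 : 0 ≤ n * t * (1 + 2 * q) := by positivity
  have hs := Real.abs_sin_le_one θ
  have hc := Real.abs_cos_le_one θ
  have a : ∀ {x y : ℝ}, 0 ≤ x → |y| ≤ 1 → |x * y| ≤ x := fun {x y} hx hy => by
    rw [abs_mul, abs_of_nonneg hx]; exact mul_le_of_le_one_right hx hy
  unfold pathBound pathCoef pathCoef'
  rcases k with p | i <;> simp only [Sum.elim_inl, Sum.elim_inr]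
  · exact ⟨(a h1 hs).trans (by linarith), (a h1 hc).trans (by linarith)⟩
  · exact ⟨(a h2 hc).trans (by linarith),
      (a (y := -Real.sin θ) h2 (by rwa [abs_neg])).trans (by linarith)⟩

theorem abs_drift_le (ht : 0 ≤ t) (hq : 0 ≤ q) (θ : ℝ) {σ : Fin n → ℝ} (hσ : ∀ i, |σ i| ≤ 1) :
    |drift h t q θ σ| ≤ pathBound n h t q := by
  have hR := abs_overlap_le hσ hσ
  have hs : |Real.sin θ ^ 2| ≤ 1 := by
    rw [abs_pow]; exact pow_le_one₀ (abs_nonneg _) (Real.abs_sin_le_one θ)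
  have hc : |Real.cos θ ^ 2| ≤ 1 := by
    rw [abs_pow]; exact pow_le_one₀ (abs_nonneg _) (Real.abs_cos_le_one θ)
  have hR2 : |overlap σ σ ^ 2| ≤ 1 := by
    rw [abs_pow]; exact pow_le_one₀ (abs_nonneg _) hR
  have hsum : |∑ i, σ i| ≤ n := (Finset.abs_sum_le_sum_abs _ _).trans
    ((Finset.sum_le_sum fun i _ => hσ i).trans (by simp))
  have h1 : |h * ∑ i, σ i| ≤ n * |h| := by
    rw [abs_mul, mul_comm]; gcongr
  have h2 : |t / 2 * n * overlap σ σ ^ 2 * Real.sin θ ^ 2| ≤ t / 2 * n := by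
    rw [abs_mul, abs_mul, abs_of_nonneg (by positivity : 0 ≤ t / 2 * n)]
    calc _ ≤ t / 2 * n * 1 * 1 := by gcongr
      _ = _ := by ring
  have h3 : |q * t * n * overlap σ σ * Real.cos θ ^ 2| ≤ q * t * n := by
    rw [abs_mul, abs_mul, abs_of_nonneg (by positivity : 0 ≤ q * t * n)]
    calc _ ≤ q * t * n * 1 * 1 := by gcongr
      _ = _ := by ring
  have h4 : 0 ≤ n * t := by positivity
  have h5 : 0 ≤ n * t * q := by positivity
  have h6 := Real.sqrt_nonneg t
  have h7 := Real.sqrt_nonneg (2 * q * t)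
  unfold drift pathBound
  have := abs_sub (h * ∑ i, σ i - t / 2 * n * overlap σ σ ^ 2 * Real.sin θ ^ 2)
    (q * t * n * overlap σ σ * Real.cos θ ^ 2)
  have := abs_sub (h * ∑ i, σ i) (t / 2 * n * overlap σ σ ^ 2 * Real.sin θ ^ 2)
  nlinarith

theorem abs_drift'_le (ht : 0 ≤ t) (hq : 0 ≤ q) (θ : ℝ) {σ : Fin n → ℝ} (hσ : ∀ i, |σ i| ≤ 1) :
    |drift' t q θ σ| ≤ pathBound n h t q := by
  have hR := abs_overlap_le hσ hσ
  have hR2 : |overlap σ σ ^ 2| ≤ 1 := by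
    rw [abs_pow]; exact pow_le_one₀ (abs_nonneg _) hR
  have h1 : |(overlap σ σ - q) ^ 2 - q ^ 2| ≤ 1 + 2 * q := by
    rw [show (overlap σ σ - q) ^ 2 - q ^ 2 = overlap σ σ ^ 2 - 2 * q * overlap σ σ by ring]
    refine (abs_sub _ _).trans (add_le_add hR2 ?_)
    rw [abs_mul, abs_of_nonneg (by positivity : 0 ≤ 2 * q)]
    exact mul_le_of_le_one_right (by positivity) hR
  have h2 := abs_sin_mul_cos_le θ
  have h3 : |drift' t q θ σ| ≤ n * t * 1 * (1 + 2 * q) := by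
    unfold drift'
    rw [abs_neg, abs_mul, abs_mul, abs_of_nonneg (by positivity : 0 ≤ n * t)]
    gcongr
  have h6 := Real.sqrt_nonneg t
  have h7 := Real.sqrt_nonneg (2 * q * t)
  have h8 : 0 ≤ n * |h| := by positivity
  unfold pathBound
  linarith

theorem hasDerivAt_pathCoef (k : (Fin n × Fin n) ⊕ Fin n) (θ : ℝ) :
    HasDerivAt (pathCoef t q k) (pathCoef' t q k θ) θ := by
  unfold pathCoef pathCoef'
  rcases k with p | i
  · exact (Real.hasDerivAt_sin θ).const_mul _
  · exact (Real.hasDerivAt_cos θ).const_mul _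

theorem measurable_drift (θ : ℝ) : Measurable (drift (n := n) h t q θ) := by
  unfold drift
  fun_prop

theorem measurable_drift' (θ : ℝ) : Measurable (drift' (n := n) t q θ) := by
  unfold drift'
  fun_prop

variable {μ : Measure ℝ} [IsProbabilityMeasure μ]

/-- The path from decoupled spins to the SK model. -/
noncomputable def singlePath (n : ℕ) (hμ : ∀ᵐ s ∂μ, s ∈ Set.Icc (-1 : ℝ) 1) (ht : 0 ≤ t)
    (hq : 0 ≤ q) : EnergyPath ((Fin n × Fin n) ⊕ Fin n) (Measure.pi fun _ : Fin n => μ) where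
  c := pathCoef t q
  c' := pathCoef' t q
  f := feature
  b := drift h t q
  b' := drift' t q
  C := pathBound n h t q
  C_nonneg := zero_le_two.trans (two_le_pathBound h ht hq)
  hasDerivAt_c := hasDerivAt_pathCoef
  abs_c_le k θ := (abs_pathCoef_le h ht hq k θ).1
  abs_c'_le k θ := (abs_pathCoef_le h ht hq k θ).2
  measurable_f := measurable_feature
  abs_f_le := (ae_abs_le_one hμ).mono fun _ hσ k =>
    (abs_feature_le k hσ).trans (two_le_pathBound h ht hq)
  measurable_b := measurable_drift h
  measurable_b' := measurable_drift'
  hasDerivAt_b := hasDerivAt_drift h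
  abs_b_le := (ae_abs_le_one hμ).mono fun _ hσ θ => abs_drift_le h ht hq θ hσ
  abs_b'_le := (ae_abs_le_one hμ).mono fun _ hσ θ => abs_drift'_le h ht hq θ hσ

theorem sq_overlap_sub_le (hq : 0 ≤ q) {σ τ : Fin n → ℝ} (hσ : ∀ i, |σ i| ≤ 1)
    (hτ : ∀ i, |τ i| ≤ 1) : |(overlap σ τ - q) ^ 2| ≤ (1 + q) ^ 2 := by
  rw [abs_pow]
  refine pow_le_pow_left₀ (abs_nonneg _) ((abs_sub _ _).trans ?_) 2
  rw [abs_of_nonneg hq]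
  exact add_le_add (abs_overlap_le hσ hτ) le_rfl

/-- The path for two replicas sharing the disorder, with the quadratic coupling
`(Λ - r sin² θ) (n/2) (R₁₂ - q)²`. -/
noncomputable def pairPath (n : ℕ) (hμ : ∀ᵐ s ∂μ, s ∈ Set.Icc (-1 : ℝ) 1) (ht : 0 ≤ t)
    (hq : 0 ≤ q) (Λ r : ℝ) : EnergyPath ((Fin n × Fin n) ⊕ Fin n)
      ((Measure.pi fun _ : Fin n => μ).prod (Measure.pi fun _ : Fin n => μ)) where
  c := pathCoef t q
  c' := pathCoef' t q
  f k p := feature k p.1 + feature k p.2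
  b θ p := drift h t q θ p.1 + drift h t q θ p.2
    + (Λ - r * Real.sin θ ^ 2) * (n / 2 * (overlap p.1 p.2 - q) ^ 2)
  b' θ p := drift' t q θ p.1 + drift' t q θ p.2
    - r * (2 * (Real.sin θ * Real.cos θ)) * (n / 2 * (overlap p.1 p.2 - q) ^ 2)
  C := 2 * pathBound n h t q + (|Λ| + 2 * |r|) * (n / 2 * (1 + q) ^ 2)
  C_nonneg := by have := two_le_pathBound (n := n) h ht hq; positivity
  hasDerivAt_c := hasDerivAt_pathCoef
  abs_c_le k θ := by
    have := two_le_pathBound (n := n) h ht hq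
    have := (abs_pathCoef_le h ht hq k θ).1
    have : 0 ≤ (|Λ| + 2 * |r|) * (n / 2 * (1 + q) ^ 2) := by positivity
    linarith
  abs_c'_le k θ := by
    have := two_le_pathBound (n := n) h ht hq
    have := (abs_pathCoef_le h ht hq k θ).2
    have : 0 ≤ (|Λ| + 2 * |r|) * (n / 2 * (1 + q) ^ 2) := by positivity
    linarith
  measurable_f k :=
    ((measurable_feature k).comp measurable_fst).add ((measurable_feature k).comp measurable_snd)
  abs_f_le := (ae_abs_le_one_prod hμ).mono fun p hp k => by
    have := two_le_pathBound (n := n) h ht hq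
    have := abs_feature_le k hp.1
    have := abs_feature_le k hp.2
    have := abs_add_le (feature k p.1) (feature k p.2)
    have : 0 ≤ (|Λ| + 2 * |r|) * (n / 2 * (1 + q) ^ 2) := by positivity
    linarith
  measurable_b θ := by
    have := measurable_drift (n := n) (t := t) (q := q) h θ
    fun_prop
  measurable_b' θ := by
    have := measurable_drift' (n := n) (t := t) (q := q) θ
    fun_prop
  hasDerivAt_b p θ := (((hasDerivAt_drift h p.1 θ).add (hasDerivAt_drift h p.2 θ)).add
    ((((hasDerivAt_sin_sq θ).const_mul r).const_sub Λ).mul_const _)).congr_deriv (by ring)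
  abs_b_le := (ae_abs_le_one_prod hμ).mono fun p hp θ => by
    refine (abs_add_le _ _).trans (add_le_add ((abs_add_le _ _).trans ?_) ?_)
    · rw [two_mul]
      exact add_le_add (abs_drift_le h ht hq θ hp.1) (abs_drift_le h ht hq θ hp.2)
    · rw [abs_mul, abs_mul _ ((overlap p.1 p.2 - q) ^ 2), abs_of_nonneg (by positivity : 0 ≤ (n : ℝ) / 2)]
      gcongr
      · refine (abs_sub _ _).trans (add_le_add le_rfl ?_)
        rw [abs_mul, abs_pow]
        have : |Real.sin θ| ^ 2 ≤ 1 := pow_le_one₀ (abs_nonneg _) (Real.abs_sin_le_one θ)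
        have := abs_nonneg r
        nlinarith
      · exact sq_overlap_sub_le hq hp.1 hp.2
  abs_b'_le := (ae_abs_le_one_prod hμ).mono fun p hp θ => by
    refine (abs_sub _ _).trans (add_le_add ((abs_add_le _ _).trans ?_) ?_)
    · rw [two_mul]
      exact add_le_add (abs_drift'_le h ht hq θ hp.1) (abs_drift'_le h ht hq θ hp.2)
    · rw [abs_mul, abs_mul _ ((overlap p.1 p.2 - q) ^ 2), abs_of_nonneg (by positivity : 0 ≤ (n : ℝ) / 2)]
      gcongr
      · rw [abs_mul, abs_mul, abs_two]
        have := abs_sin_mul_cos_le θ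
        have := abs_nonneg r
        have := abs_nonneg Λ
        nlinarith
      · exact sq_overlap_sub_le hq hp.1 hp.2

end Paths

end GeneralSpinSK

/-! ### The sum rule and the bound for coupled replicas. -/

namespace GeneralSpinSK

/-- Jensen's inequality for the Gibbs measure of `W`, obtained from the tangent line of `exp` at the
mean of `Y`. -/
theorem log_integral_exp_add_ge {S : Type*} [MeasurableSpace S] {m : Measure S}
    [IsProbabilityMeasure m] {W Y : S → ℝ} {M C : ℝ} (hW : Measurable W) (hY : Measurable Y)
    (hM : ∀ᵐ s ∂m, |W s| ≤ M) (hC : ∀ᵐ s ∂m, |Y s| ≤ C) :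
    Real.log (∫ s, Real.exp (W s) ∂m) + ∫ s, Y s ∂(m.tilted W)
      ≤ Real.log (∫ s, Real.exp (W s + Y s) ∂m) := by
  have := isProbabilityMeasure_tilted_of_bdd hW hM
  have hp := integral_exp_pos_of_bdd hW hM
  have iY := integrable_tilted_of_bdd hW hY hM hC
  have ieY : Integrable (fun s => Real.exp (Y s)) (m.tilted W) :=
    integrable_exp_of_bdd hY (tilted_absolutelyContinuous m W |>.ae_le hC)
  set a := ∫ s, Y s ∂(m.tilted W) with ha
  have h1 : Real.exp a ≤ ∫ s, Real.exp (Y s) ∂(m.tilted W) := by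
    have h2 : ∫ s, Real.exp a * (1 + (Y s - a)) ∂(m.tilted W) = Real.exp a := by
      have h3 : ∫ s, (1 + (Y s - a)) ∂(m.tilted W) = 1 + (a - a) := by
        rw [integral_add (integrable_const _)
          (show Integrable (fun s => Y s - a) (m.tilted W) from iY.sub (integrable_const _)),
          integral_sub iY (integrable_const _), ← ha]
        simp
      rw [integral_const_mul, h3]
      ring
    rw [← h2]
    refine integral_mono (((integrable_const _).add (iY.sub (integrable_const _))).const_mul _)
      ieY fun s => ?_
    have h3 := Real.add_one_le_exp (Y s - a)
    calc Real.exp a * (1 + (Y s - a)) ≤ Real.exp a * Real.exp (Y s - a) := by gcongr; linarith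
      _ = Real.exp (Y s) := by rw [← Real.exp_add]; ring_nf
  rw [integral_tilted_eq_div, le_div_iff₀ hp] at h1
  have e : ∀ s, Real.exp (Y s) * Real.exp (W s) = Real.exp (W s + Y s) := fun s => by
    rw [← Real.exp_add, add_comm]
  simp only [e] at h1
  calc _ = Real.log (Real.exp a * ∫ s, Real.exp (W s) ∂m) := by
        rw [Real.log_mul (Real.exp_pos _).ne' hp.ne', Real.log_exp, add_comm]
    _ ≤ _ := Real.log_le_log (mul_pos (Real.exp_pos _) hp) h1

theorem antitoneOn_Icc_of_hasDerivAt_nonpos {f f' : ℝ → ℝ} {a b : ℝ}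
    (hf : ∀ x, HasDerivAt f (f' x) x) (h : ∀ x ∈ Set.Icc a b, f' x ≤ 0) :
    AntitoneOn f (Set.Icc a b) :=
  antitoneOn_of_deriv_nonpos (convex_Icc a b)
    (fun x _ => (hf x).continuousAt.continuousWithinAt)
    (fun x _ => (hf x).differentiableAt.differentiableWithinAt)
    (fun x hx => by rw [(hf x).deriv]; exact h x (interior_subset hx))

/-- Integrability need not be checked: a non-integrable function has integral `0` by convention,
which is where `0 ≤ C` enters. -/
theorem integral_le_of_forall_le_const {S : Type*} [MeasurableSpace S] {m : Measure S}
    [IsProbabilityMeasure m] {f : S → ℝ} {C : ℝ} (hC : 0 ≤ C) (hf : ∀ s, f s ≤ C) :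
    ∫ s, f s ∂m ≤ C := by
  by_cases hi : Integrable f m
  · simpa using integral_mono hi (integrable_const C) hf
  · rwa [integral_undef hi]

theorem measurable_sq_overlap_sub {n : ℕ} {q : ℝ} :
    Measurable fun p : (Fin n → ℝ) × (Fin n → ℝ) => (overlap p.1 p.2 - q) ^ 2 := by
  fun_prop

theorem ae_sq_overlap_sub_le {μ : Measure ℝ} [IsProbabilityMeasure μ] {n : ℕ} {q : ℝ}
    (hμ : ∀ᵐ s ∂μ, s ∈ Set.Icc (-1 : ℝ) 1) (hq : 0 ≤ q) :
    ∀ᵐ p ∂((Measure.pi fun _ : Fin n => μ).prod (Measure.pi fun _ : Fin n => μ)),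
      |(overlap p.1 p.2 - q) ^ 2| ≤ (1 + q) ^ 2 :=
  (ae_abs_le_one_prod hμ).mono fun _ hp => sq_overlap_sub_le hq hp.1 hp.2

namespace EnergyPath

variable {K : Type*} [Fintype K] {S : Type*} [MeasurableSpace S] {m : Measure S}
  [IsProbabilityMeasure m] (P : EnergyPath K m)

theorem isProbabilityMeasure_tilted_prod (θ : ℝ) (g : K → ℝ) :
    IsProbabilityMeasure
      ((m.prod m).tilted fun r => P.energy θ g r.1 + P.energy θ g r.2) := by
  refine isProbabilityMeasure_tilted_of_bdd (M := P.bound g + P.bound g)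
    (((P.measurable_energy θ g).comp measurable_fst).add
      ((P.measurable_energy θ g).comp measurable_snd)) ?_
  filter_upwards [Measure.quasiMeasurePreserving_fst.ae (P.abs_energy_le' θ g),
    Measure.quasiMeasurePreserving_snd.ae (P.abs_energy_le' θ g)] with r h1 h2
  exact (abs_add_le _ _).trans (add_le_add h1 h2)

theorem integrable_mul_tilted_prod (θ : ℝ) (g : K → ℝ) (k : K) :
    Integrable (fun r => P.f k r.1 * P.f k r.2)
      ((m.prod m).tilted fun r => P.energy θ g r.1 + P.energy θ g r.2) := by
  have := P.isProbabilityMeasure_tilted_prod θ g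
  refine Integrable.of_bound (((P.measurable_f k).comp measurable_fst).mul
    ((P.measurable_f k).comp measurable_snd)).aestronglyMeasurable (P.C * P.C)
    (tilted_absolutelyContinuous (m.prod m) _ |>.ae_le ?_)
  filter_upwards [Measure.quasiMeasurePreserving_fst.ae (P.abs_f_le' k),
    Measure.quasiMeasurePreserving_snd.ae (P.abs_f_le' k)] with r h1 h2
  rw [Real.norm_eq_abs, abs_mul]
  exact mul_le_mul h1 h2 (abs_nonneg _) P.C_nonneg

theorem sum_mul_sq_gibbs (θ : ℝ) (g : K → ℝ) (a : K → ℝ) :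
    ∑ k, a k * (∫ s, P.f k s ∂(m.tilted (P.energy θ g))) ^ 2
      = ∫ r, ∑ k, a k * (P.f k r.1 * P.f k r.2)
        ∂((m.prod m).tilted fun r => P.energy θ g r.1 + P.energy θ g r.2) := by
  rw [integral_finsetSum _ fun k _ => (P.integrable_mul_tilted_prod θ g k).const_mul _]
  refine Finset.sum_congr rfl fun k _ => ?_
  rw [sq, integral_tilted_mul_integral_tilted, integral_const_mul]

theorem le_sum_mul_sq_gibbs (θ : ℝ) (g : K → ℝ) (a : K → ℝ) {C : ℝ}
    (hC : ∀ r r', C ≤ ∑ k, a k * (P.f k r * P.f k r')) :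
    C ≤ ∑ k, a k * (∫ s, P.f k s ∂(m.tilted (P.energy θ g))) ^ 2 := by
  have := P.isProbabilityMeasure_tilted_prod θ g
  rw [sum_mul_sq_gibbs]
  simpa using integral_mono (integrable_const C)
    (integrable_finsetSum _ fun k _ => (P.integrable_mul_tilted_prod θ g k).const_mul _)
    fun r => hC r.1 r.2

end EnergyPath

variable {μ : Measure ℝ} [IsProbabilityMeasure μ] {n : ℕ} (h : ℝ) {t q : ℝ}
  (hμ : ∀ᵐ s ∂μ, s ∈ Set.Icc (-1 : ℝ) 1) (ht : 0 ≤ t) (hq : 0 ≤ q)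

theorem pairPath_energy (Λ r θ : ℝ) (g : (Fin n × Fin n) ⊕ Fin n → ℝ)
    (p : (Fin n → ℝ) × (Fin n → ℝ)) :
    (pairPath h n hμ ht hq Λ r).energy θ g p = (singlePath h n hμ ht hq).energy θ g p.1
      + (singlePath h n hμ ht hq).energy θ g p.2
      + (Λ - r * Real.sin θ ^ 2) * (n / 2 * (overlap p.1 p.2 - q) ^ 2) := by
  simp only [EnergyPath.energy, pairPath, singlePath, mul_add, Finset.sum_add_distrib]
  ring

theorem pairPath_zero_energy (θ : ℝ) (g : (Fin n × Fin n) ⊕ Fin n → ℝ) :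
    (pairPath h n hμ ht hq 0 0).energy θ g = fun p => (singlePath h n hμ ht hq).energy θ g p.1
      + (singlePath h n hμ ht hq).energy θ g p.2 := by
  ext p; rw [pairPath_energy]; simp

/-- The mean squared deviation of the overlap of two replicas from `q`. -/
noncomputable def overlapVar (n : ℕ) (θ : ℝ) : ℝ :=
  ∫ g, ∫ p, (overlap p.1 p.2 - q) ^ 2
      ∂(((Measure.pi fun _ : Fin n => μ).prod (Measure.pi fun _ : Fin n => μ)).tilted
        ((pairPath h n hμ ht hq 0 0).energy θ g))
    ∂(Measure.pi fun _ : (Fin n × Fin n) ⊕ Fin n => gaussianReal 0 1)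

theorem integrable_gibbs_sq_overlap_sub (θ : ℝ) :
    Integrable (fun g => ∫ p, (overlap p.1 p.2 - q) ^ 2
      ∂(((Measure.pi fun _ : Fin n => μ).prod (Measure.pi fun _ : Fin n => μ)).tilted
        ((pairPath h n hμ ht hq 0 0).energy θ g)))
      (Measure.pi fun _ : (Fin n × Fin n) ⊕ Fin n => gaussianReal 0 1) :=
  (pairPath h n hμ ht hq 0 0).integrable_gibbs θ measurable_sq_overlap_sub
    (ae_sq_overlap_sub_le hμ hq)

theorem overlapVar_nonneg (θ : ℝ) : 0 ≤ overlapVar h hμ ht hq n θ :=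
  integral_nonneg fun _ => integral_nonneg fun _ => sq_nonneg _

/-- Guerra's sum rule along the path. -/
theorem hasDerivAt_logZ_singlePath (θ : ℝ) :
    HasDerivAt (singlePath h n hμ ht hq).logZ
      (-(n * t * (Real.sin θ * Real.cos θ) * (overlapVar h hμ ht hq n θ - q ^ 2))) θ := by
  refine ((singlePath h n hμ ht hq).hasDerivAt_logZ θ).congr_deriv ?_
  -- The drift was chosen to cancel the self-overlap terms identically in `σ`; only the overlap of
  -- distinct replicas survives.
  have e1 : ∀ σ, (singlePath h n hμ ht hq).b' θ σ + ∑ k, (singlePath h n hμ ht hq).c k θ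
      * (singlePath h n hμ ht hq).c' k θ * (singlePath h n hμ ht hq).f k σ ^ 2 = 0 := by
    intro σ
    have := sum_pathCoef_mul ht hq θ σ σ
    simp only [singlePath, drift', sq (feature _ σ)]
    rw [this]; ring
  have e2 : ∀ g, ∑ k, (singlePath h n hμ ht hq).c k θ * (singlePath h n hμ ht hq).c' k θ
      * (∫ σ, (singlePath h n hμ ht hq).f k σ
        ∂((Measure.pi fun _ : Fin n => μ).tilted ((singlePath h n hμ ht hq).energy θ g))) ^ 2
      = n * t * (Real.sin θ * Real.cos θ) * ((∫ p, (overlap p.1 p.2 - q) ^ 2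
        ∂(((Measure.pi fun _ : Fin n => μ).prod (Measure.pi fun _ : Fin n => μ)).tilted
        ((pairPath h n hμ ht hq 0 0).energy θ g))) - q ^ 2) := by
    intro g
    have hI := (pairPath h n hμ ht hq 0 0).integrable_tilted θ g
      (measurable_sq_overlap_sub (q := q)) (ae_sq_overlap_sub_le hμ hq)
    have := isProbabilityMeasure_tilted_of_bdd ((pairPath h n hμ ht hq 0 0).measurable_energy θ g)
      ((pairPath h n hμ ht hq 0 0).abs_energy_le' θ g)
    have hc : ∫ p, ((overlap p.1 p.2 - q) ^ 2 - q ^ 2)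
        ∂(((Measure.pi fun _ : Fin n => μ).prod (Measure.pi fun _ : Fin n => μ)).tilted
        ((pairPath h n hμ ht hq 0 0).energy θ g)) = (∫ p, (overlap p.1 p.2 - q) ^ 2
        ∂(((Measure.pi fun _ : Fin n => μ).prod (Measure.pi fun _ : Fin n => μ)).tilted
        ((pairPath h n hμ ht hq 0 0).energy θ g))) - q ^ 2 := by
      rw [integral_sub hI (integrable_const _)]
      simp
    rw [← hc]
    rw [(singlePath h n hμ ht hq).sum_mul_sq_gibbs θ g, ← integral_const_mul, pairPath_zero_energy]
    congr 1
    ext p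
    exact sum_pathCoef_mul ht hq θ p.1 p.2
  simp only [e1, e2, integral_zero, zero_sub]
  rw [integral_neg, integral_const_mul, integral_sub (integrable_gibbs_sq_overlap_sub h hμ ht hq θ)
    (integrable_const _)]
  simp [overlapVar]

/-- The quadratic coupling, decreasing at the right rate, absorbs the replica overlap. -/
theorem logZ_pairPath_le (Λ : ℝ) {θ : ℝ} (hθ : θ ∈ Set.Icc 0 (Real.pi / 2)) :
    (pairPath h n hμ ht hq Λ (2 * t)).logZ θ
      ≤ (pairPath h n hμ ht hq Λ (2 * t)).logZ 0 + n * t * q ^ 2 * Real.sin θ ^ 2 := by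
  set P := pairPath h n hμ ht hq Λ (2 * t) with hP
  -- It suffices that the coupled free energy minus the allowed growth is antitone on the quarter
  -- circle, where `sin θ cos θ ≥ 0`.
  have hd : ∀ θ, HasDerivAt (fun θ => P.logZ θ - n * t * q ^ 2 * Real.sin θ ^ 2) _ θ := fun θ =>
    (P.hasDerivAt_logZ θ).sub ((hasDerivAt_sin_sq θ).const_mul (n * t * q ^ 2))
  have hmono := antitoneOn_Icc_of_hasDerivAt_nonpos (a := 0) (b := Real.pi / 2) hd ?_
  · have := hmono (Set.left_mem_Icc.2 (by positivity)) hθ hθ.1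
    simp only [Real.sin_zero] at this
    linarith
  · intro θ hθ
    have hsc : 0 ≤ Real.sin θ * Real.cos θ := mul_nonneg
      (Real.sin_nonneg_of_nonneg_of_le_pi hθ.1 (by linarith [hθ.2, Real.pi_pos]))
      (Real.cos_nonneg_of_neg_pi_div_two_le_of_le (by linarith [hθ.1, Real.pi_pos]) hθ.2)
    set a : ℝ := n * t * (Real.sin θ * Real.cos θ) with ha
    have ha0 : 0 ≤ a := by positivity
    have hcov : ∀ σ τ : Fin n → ℝ, ∑ k, pathCoef t q k θ * pathCoef' t q k θ
        * (feature k σ * feature k τ) = a * ((overlap σ τ - q) ^ 2 - q ^ 2) :=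
      sum_pathCoef_mul ht hq θ
    -- The drifts remove the self-overlaps of both replicas. The remaining cross term `2a(R₁₂ - q)²`
    -- is cancelled by the decay of the coupling, which fixes the rate `r = 2t`.
    have e1 : ∀ p, P.b' θ p + ∑ k, P.c k θ * P.c' k θ * P.f k p ^ 2 = -(2 * a * q ^ 2) := by
      intro p
      have h0 : ∑ k, P.c k θ * P.c' k θ * P.f k p ^ 2
          = ∑ k, pathCoef t q k θ * pathCoef' t q k θ * (feature k p.1 * feature k p.1)
          + ∑ k, pathCoef t q k θ * pathCoef' t q k θ * (feature k p.2 * feature k p.2)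
          + 2 * ∑ k, pathCoef t q k θ * pathCoef' t q k θ * (feature k p.1 * feature k p.2) := by
        rw [Finset.mul_sum, ← Finset.sum_add_distrib, ← Finset.sum_add_distrib]
        refine Finset.sum_congr rfl fun k _ => ?_
        simp only [hP, pairPath]
        ring
      rw [h0, hcov, hcov, hcov]
      simp only [hP, pairPath, drift', ← ha]
      have : 2 * t * (2 * (Real.sin θ * Real.cos θ)) * (n / 2 * (overlap p.1 p.2 - q) ^ 2)
          = 2 * a * (overlap p.1 p.2 - q) ^ 2 := by rw [ha]; ring
      rw [this]
      ring
    -- The four overlaps between two copies of the pair enter through squares `(R - q)² ≥ 0` and are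
    -- discarded, leaving `-aq²` for each. Together with `e1` the derivative is at most `4aq² - 2aq²
    -- = 2aq²`.
    have e2 : ∀ g, -(4 * a * q ^ 2) ≤ ∑ k, P.c k θ * P.c' k θ
        * (∫ p, P.f k p ∂(((Measure.pi fun _ : Fin n => μ).prod
          (Measure.pi fun _ : Fin n => μ)).tilted (P.energy θ g))) ^ 2 := by
      intro g
      refine P.le_sum_mul_sq_gibbs θ g (fun k => P.c k θ * P.c' k θ) fun r r' => ?_
      have h0 : ∑ k, P.c k θ * P.c' k θ * (P.f k r * P.f k r')
          = ∑ k, pathCoef t q k θ * pathCoef' t q k θ * (feature k r.1 * feature k r'.1)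
          + ∑ k, pathCoef t q k θ * pathCoef' t q k θ * (feature k r.1 * feature k r'.2)
          + ∑ k, pathCoef t q k θ * pathCoef' t q k θ * (feature k r.2 * feature k r'.1)
          + ∑ k, pathCoef t q k θ * pathCoef' t q k θ * (feature k r.2 * feature k r'.2) := by
        rw [← Finset.sum_add_distrib, ← Finset.sum_add_distrib, ← Finset.sum_add_distrib]
        refine Finset.sum_congr rfl fun k _ => ?_
        simp only [hP, pairPath]
        ring
      rw [h0, hcov, hcov, hcov, hcov]
      have h1 := mul_nonneg ha0 (sq_nonneg (overlap r.1 r'.1 - q))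
      have h2 := mul_nonneg ha0 (sq_nonneg (overlap r.1 r'.2 - q))
      have h3 := mul_nonneg ha0 (sq_nonneg (overlap r.2 r'.1 - q))
      have h4 := mul_nonneg ha0 (sq_nonneg (overlap r.2 r'.2 - q))
      linarith
    simp only [e1]
    have hle : ∀ g, (∫ _p, -(2 * a * q ^ 2) ∂(((Measure.pi fun _ : Fin n => μ).prod
          (Measure.pi fun _ : Fin n => μ)).tilted (P.energy θ g)))
        - ∑ k, P.c k θ * P.c' k θ
        * (∫ p, P.f k p ∂(((Measure.pi fun _ : Fin n => μ).prod
          (Measure.pi fun _ : Fin n => μ)).tilted (P.energy θ g))) ^ 2 ≤ 2 * a * q ^ 2 := by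
      intro g
      have := isProbabilityMeasure_tilted_of_bdd (P.measurable_energy θ g)
        (P.abs_energy_le' θ g)
      have := e2 g
      simp only [integral_const, probReal_univ, one_smul]
      linarith
    have hint := integral_le_of_forall_le_const
      (m := Measure.pi fun _ : (Fin n × Fin n) ⊕ Fin n => gaussianReal 0 1)
      (by positivity : 0 ≤ 2 * a * q ^ 2) hle
    have : n * t * q ^ 2 * (2 * (Real.sin θ * Real.cos θ)) = 2 * a * q ^ 2 := by rw [ha]; ring
    rw [this]
    linarith

end GeneralSpinSK

namespace GeneralSpinSK

/-! ### Closing the loop between the overlap variance and the deficit in the formula. -/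

section Bounds

variable {μ : Measure ℝ} [IsProbabilityMeasure μ] {n : ℕ} (h : ℝ) {t q : ℝ}
  (hμ : ∀ᵐ s ∂μ, s ∈ Set.Icc (-1 : ℝ) 1) (ht : 0 ≤ t) (hq : 0 ≤ q)

theorem log_integral_exp_pairPath_zero (θ : ℝ) (g : (Fin n × Fin n) ⊕ Fin n → ℝ) :
    Real.log (∫ p, Real.exp ((pairPath h n hμ ht hq 0 0).energy θ g p)
        ∂((Measure.pi fun _ : Fin n => μ).prod (Measure.pi fun _ : Fin n => μ)))
      = 2 * Real.log (∫ σ, Real.exp ((singlePath h n hμ ht hq).energy θ g σ)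
        ∂(Measure.pi fun _ : Fin n => μ)) := by
  simp only [pairPath_zero_energy, Real.exp_add]
  rw [integral_prod_mul (fun σ => Real.exp ((singlePath h n hμ ht hq).energy θ g σ))
    (fun σ => Real.exp ((singlePath h n hμ ht hq).energy θ g σ)), ← sq, Real.log_pow]
  norm_num

/-- Jensen's inequality around the uncoupled pair, whose log-partition function is twice that of one
replica, bounds the overlap variance by the cost of the coupling. -/
theorem two_mul_logZ_add_le (Λ r θ : ℝ) :
    2 * (singlePath h n hμ ht hq).logZ θ
        + (Λ - r * Real.sin θ ^ 2) * (n / 2) * overlapVar h hμ ht hq n θ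
      ≤ (pairPath h n hμ ht hq Λ r).logZ θ := by
  unfold EnergyPath.logZ overlapVar
  rw [← integral_const_mul, ← integral_const_mul, ← integral_add
    (((singlePath h n hμ ht hq).integrable_log θ).const_mul 2)
    ((integrable_gibbs_sq_overlap_sub h hμ ht hq θ).const_mul _)]
  refine integral_mono ((((singlePath h n hμ ht hq).integrable_log θ).const_mul 2).add
    ((integrable_gibbs_sq_overlap_sub h hμ ht hq θ).const_mul _))
    ((pairPath h n hμ ht hq Λ r).integrable_log θ) fun g => ?_
  have := log_integral_exp_add_ge ((pairPath h n hμ ht hq 0 0).measurable_energy θ g)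
    ((measurable_sq_overlap_sub (n := n) (q := q)).const_mul ((Λ - r * Real.sin θ ^ 2) * (n / 2)))
    ((pairPath h n hμ ht hq 0 0).abs_energy_le' θ g)
    (C := |(Λ - r * Real.sin θ ^ 2) * (n / 2)| * (1 + q) ^ 2)
    ((ae_sq_overlap_sub_le hμ hq).mono fun p hp => by
      rw [abs_mul]; gcongr)
  rw [log_integral_exp_pairPath_zero, integral_const_mul] at this
  refine this.trans_eq ?_
  congr 2
  ext p
  rw [pairPath_energy, pairPath_energy]
  ring_nf

/-- A bound on the free energy cost of coupling two replicas at the decoupled end of the path gives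
concentration of the overlap and the replica-symmetric formula at the other end. -/
theorem overlapVar_le_and_logZ_ge (hn : 0 < n) (ht' : t ≤ 1 / 128) {ε : ℝ}
    (hε : (pairPath h n hμ ht hq (1 / 16) (2 * t)).logZ 0
      ≤ 2 * (singlePath h n hμ ht hq).logZ 0 + ε) :
    overlapVar h hμ ht hq n (Real.pi / 2) ≤ 128 * ε / n ∧
    (singlePath h n hμ ht hq).logZ 0 + n * t * q ^ 2 / 2 - ε / 2
      ≤ (singlePath h n hμ ht hq).logZ (Real.pi / 2) ∧
    (singlePath h n hμ ht hq).logZ (Real.pi / 2)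
      ≤ (singlePath h n hμ ht hq).logZ 0 + n * t * q ^ 2 / 2 := by
  have hn' : (0 : ℝ) < n := by exact_mod_cast hn
  set P := singlePath h n hμ ht hq with hP
  set D := overlapVar h hμ ht hq n with hD
  have hpi : (0 : ℝ) ≤ Real.pi / 2 := by positivity
  have hsc : ∀ θ ∈ Set.Icc (0 : ℝ) (Real.pi / 2), 0 ≤ Real.sin θ * Real.cos θ := fun θ hθ =>
    mul_nonneg (Real.sin_nonneg_of_nonneg_of_le_pi hθ.1 (by linarith [hθ.2, Real.pi_pos]))
      (Real.cos_nonneg_of_neg_pi_div_two_le_of_le (by linarith [hθ.1, Real.pi_pos]) hθ.2)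
  -- By the sum rule the derivative is `-n t sin θ cos θ D θ`. This alone gives the upper bound on
  -- `logZ`.
  have h1 : AntitoneOn (fun θ => P.logZ θ - n * t * q ^ 2 / 2 * Real.sin θ ^ 2)
      (Set.Icc 0 (Real.pi / 2)) := by
    refine antitoneOn_Icc_of_hasDerivAt_nonpos (fun θ =>
      (hasDerivAt_logZ_singlePath h hμ ht hq θ).sub ((hasDerivAt_sin_sq θ).const_mul _)) ?_
    intro θ hθ
    have := hsc θ hθ
    have h2 : 0 ≤ n * t * (Real.sin θ * Real.cos θ) * D θ :=
      mul_nonneg (by positivity) (overlapVar_nonneg h hμ ht hq θ)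
    linarith
  have hDle : ∀ θ ∈ Set.Icc (0 : ℝ) (Real.pi / 2), D θ ≤ 64 / n * (ε + 2 * (P.logZ 0
      - P.logZ (Real.pi / 2) + n * t * q ^ 2 / 2)) := by
    intro θ hθ
    have e1 := two_mul_logZ_add_le (n := n) h hμ ht hq (1 / 16) (2 * t) θ
    have e2 := logZ_pairPath_le (n := n) h hμ ht hq (1 / 16) hθ
    have e3 := h1 hθ (Set.right_mem_Icc.2 hpi) hθ.2
    simp only [Real.sin_pi_div_two] at e3
    -- As `2t ≤ 1/64`, a coupling of at least `1/32` remains along the whole path.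
    have e4 : 1 / 32 * (n / 2) * D θ
        ≤ (1 / 16 - 2 * t * Real.sin θ ^ 2) * (n / 2) * D θ := by
      have := overlapVar_nonneg (n := n) h hμ ht hq θ
      have hs : Real.sin θ ^ 2 ≤ 1 := Real.sin_sq_le_one θ
      gcongr
      nlinarith [sq_nonneg (Real.sin θ)]
    rw [div_mul_eq_mul_div, le_div_iff₀ hn']
    linarith
  -- `M` is the total deficit in the replica-symmetric formula; by `h1` the deficit accumulated up
  -- to any `θ` is at most `M`.
  set M := P.logZ 0 - P.logZ (Real.pi / 2) + n * t * q ^ 2 / 2 with hM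
  -- The sum rule in the other direction: the uniform bound on `D` limits the deficit `M` that can
  -- accumulate.
  have h2 : AntitoneOn (fun θ => (n * t * q ^ 2 / 2 - n * t * (64 / n * (ε + 2 * M)) / 2)
      * Real.sin θ ^ 2 - P.logZ θ) (Set.Icc 0 (Real.pi / 2)) := by
    refine antitoneOn_Icc_of_hasDerivAt_nonpos (fun θ =>
      ((hasDerivAt_sin_sq θ).const_mul _).sub (hasDerivAt_logZ_singlePath h hμ ht hq θ)) ?_
    intro θ hθ
    have := hsc θ hθ
    have h3 : n * t * (Real.sin θ * Real.cos θ) * D θ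
        ≤ n * t * (Real.sin θ * Real.cos θ) * (64 / n * (ε + 2 * M)) := by
      gcongr
      exact hDle θ hθ
    linarith
  have e1 := h1 (Set.left_mem_Icc.2 hpi) (Set.right_mem_Icc.2 hpi) hpi
  have e2 := h2 (Set.left_mem_Icc.2 hpi) (Set.right_mem_Icc.2 hpi) hpi
  simp only [Real.sin_pi_div_two, Real.sin_zero] at e1 e2
  have e3 : n * t * (64 / n * (ε + 2 * M)) = 64 * t * (ε + 2 * M) := by field_simp
  rw [e3] at e2
  have hM0 : 0 ≤ M := by rw [hM]; linarith
  have hε0 : 0 ≤ ε + 2 * M := by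
    have := (overlapVar_nonneg (n := n) h hμ ht hq 0).trans (hDle 0 (Set.left_mem_Icc.2 hpi))
    exact nonneg_of_mul_nonneg_right this (by positivity)
  -- Since `32t ≤ 1/4`, the self-consistent bound reads `M ≤ ε/4 + M/2`.
  have e4 : M ≤ ε / 2 := by
    have : M ≤ 32 * t * (ε + 2 * M) := by rw [hM] at e2 ⊢; linarith
    nlinarith
  refine ⟨?_, by rw [hM] at e4; linarith, by linarith⟩
  refine (hDle _ (Set.right_mem_Icc.2 hpi)).trans ?_
  rw [div_mul_eq_mul_div]
  exact div_le_div_of_nonneg_right (by linarith) hn'.le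

end Bounds

end GeneralSpinSK

namespace GeneralSpinSK

/-! ### Marginals and products of product measures. -/

section Projections

variable {ι ι' : Type*} [Fintype ι] [Fintype ι']

theorem measurePreserving_comp_inl (ν : Measure ℝ) [IsProbabilityMeasure ν] :
    MeasurePreserving (fun (g : ι ⊕ ι' → ℝ) (i : ι) => g (Sum.inl i))
      (Measure.pi fun _ => ν) (Measure.pi fun _ => ν) :=
  measurePreserving_fst.comp (measurePreserving_sumPiEquivProdPi fun _ : ι ⊕ ι' => ν)

theorem integral_prod_pi_pi {α : Type*} [MeasurableSpace α] (μ : Measure α)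
    [IsProbabilityMeasure μ] (k : ι → α × α → ℝ) :
    ∫ p, ∏ i, k i (p.1 i, p.2 i) ∂((Measure.pi fun _ : ι => μ).prod (Measure.pi fun _ : ι => μ))
      = ∏ i, ∫ r, k i r ∂(μ.prod μ) := by
  rw [← (measurePreserving_arrowProdEquivProdArrow α α ι (fun _ => μ) (fun _ => μ)).integral_comp',
    ← integral_fintype_prod_eq_prod]
  rfl

end Projections

/-! ### One site: field derivative and replica moment generating function. -/

section SingleSite

/-- The energy of one spin in the field `u` with quadratic weight `v`. -/
def siteEnergy (u v s : ℝ) : ℝ := u * s + v * s ^ 2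

variable {μ : Measure ℝ}

@[fun_prop]
theorem measurable_siteEnergy {X : Type*} [MeasurableSpace X] {u v s : X → ℝ} (hu : Measurable u)
    (hv : Measurable v) (hs : Measurable s) : Measurable fun x => siteEnergy (u x) (v x) (s x) := by
  unfold siteEnergy
  fun_prop

theorem abs_siteEnergy_le (u v : ℝ) {s : ℝ} (hs : |s| ≤ 1) : |siteEnergy u v s| ≤ |u| + |v| := by
  unfold siteEnergy
  refine (abs_add_le _ _).trans (add_le_add ?_ ?_)
  · rw [abs_mul]; exact mul_le_of_le_one_right (abs_nonneg _) hs
  · rw [abs_mul, abs_pow]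
    exact mul_le_of_le_one_right (abs_nonneg _) (pow_le_one₀ (abs_nonneg _) hs)

theorem ae_abs_siteEnergy_le (hμ : ∀ᵐ s ∂μ, s ∈ Set.Icc (-1 : ℝ) 1) (u v : ℝ) :
    ∀ᵐ s ∂μ, |siteEnergy u v s| ≤ |u| + |v| :=
  hμ.mono fun _ hs => abs_siteEnergy_le u v (abs_le.2 hs)

theorem ae_abs_mul_sub_le (hμ : ∀ᵐ s ∂μ, s ∈ Set.Icc (-1 : ℝ) 1) {q : ℝ}
    (hq : q ∈ Set.Icc (0 : ℝ) 1) : ∀ᵐ r ∂(μ.prod μ), |r.1 * r.2 - q| ≤ 2 := by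
  filter_upwards [Measure.quasiMeasurePreserving_fst.ae hμ,
    Measure.quasiMeasurePreserving_snd.ae hμ] with r h1 h2
  refine (abs_sub _ _).trans ?_
  rw [abs_mul, abs_of_nonneg hq.1]
  have := mul_le_one₀ (abs_le.2 h1) (abs_nonneg r.2) (abs_le.2 h2)
  linarith [hq.2]

/-- The moment generating function of the centered replica product at one site. -/
noncomputable def siteMGF (μ : Measure ℝ) (q u v c : ℝ) : ℝ :=
  ∫ r, Real.exp (c * (r.1 * r.2 - q))
    ∂((μ.prod μ).tilted fun r => siteEnergy u v r.1 + siteEnergy u v r.2)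

theorem siteMGF_nonneg (q u v c : ℝ) : 0 ≤ siteMGF μ q u v c :=
  integral_nonneg fun _ => (Real.exp_pos _).le

theorem ae_abs_siteEnergy_add_le (hμ : ∀ᵐ s ∂μ, s ∈ Set.Icc (-1 : ℝ) 1) (u v : ℝ) :
    ∀ᵐ r ∂(μ.prod μ), |siteEnergy u v r.1 + siteEnergy u v r.2| ≤ 2 * (|u| + |v|) := by
  filter_upwards [Measure.quasiMeasurePreserving_fst.ae (ae_abs_siteEnergy_le hμ u v),
    Measure.quasiMeasurePreserving_snd.ae (ae_abs_siteEnergy_le hμ u v)] with r h1 h2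
  rw [two_mul]
  exact (abs_add_le _ _).trans (add_le_add h1 h2)

variable [IsProbabilityMeasure μ]

theorem abs_phi_le (hμ : ∀ᵐ s ∂μ, s ∈ Set.Icc (-1 : ℝ) 1) (u v : ℝ) :
    |phi μ u v| ≤ |u| + |v| :=
  abs_log_integral_exp_le (by fun_prop) (ae_abs_siteEnergy_le hμ u v)

theorem measurable_phi (v : ℝ) : Measurable fun u => phi μ u v :=
  measurable_log_integral_exp (W := fun u s => siteEnergy u v s)
    (by unfold Function.uncurry; fun_prop)

theorem dphi_eq (hμ : ∀ᵐ s ∂μ, s ∈ Set.Icc (-1 : ℝ) 1) (u v : ℝ) :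
    dphi μ u v = ∫ s, s ∂(μ.tilted (siteEnergy u v)) := by
  refine (hasDerivAt_log_integral_exp (m := μ) (W := fun u s => siteEnergy u v s)
    (W' := fun _ s => s) (M := |u| + 1 + |v|) u (fun _ => by fun_prop) (fun _ => measurable_id)
    ?_ ?_ ?_).deriv
  · filter_upwards [hμ] with s hs y hy
    refine (abs_siteEnergy_le y v (abs_le.2 hs)).trans ?_
    rw [Metric.mem_ball, Real.dist_eq] at hy
    have := abs_sub_abs_le_abs_sub y u
    linarith
  · filter_upwards [hμ] with s hs y _
    have := abs_le.2 hs
    have := abs_nonneg u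
    have := abs_nonneg v
    linarith
  · intro s y
    unfold siteEnergy
    exact (((hasDerivAt_id y).mul_const s).add_const _).congr_deriv (one_mul s)

theorem abs_dphi_le_one (hμ : ∀ᵐ s ∂μ, s ∈ Set.Icc (-1 : ℝ) 1) (u v : ℝ) : |dphi μ u v| ≤ 1 := by
  rw [dphi_eq hμ]
  exact abs_integral_tilted_le (by unfold siteEnergy; fun_prop) (ae_abs_siteEnergy_le hμ u v)
    (hμ.mono fun _ hs => abs_le.2 hs)

theorem measurable_dphi (hμ : ∀ᵐ s ∂μ, s ∈ Set.Icc (-1 : ℝ) 1) (v : ℝ) :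
    Measurable fun u => dphi μ u v := by
  simp only [dphi_eq hμ]
  exact measurable_integral_tilted (W := fun u => siteEnergy u v) (f := fun _ s => s)
    (by unfold Function.uncurry; fun_prop) measurable_snd

theorem integrable_dphi_sq (hμ : ∀ᵐ s ∂μ, s ∈ Set.Icc (-1 : ℝ) 1) (h a v : ℝ) :
    Integrable (fun g => dphi μ (h + g * a) v ^ 2) (gaussianReal 0 1) := by
  refine Integrable.of_bound (((measurable_dphi hμ v).comp (by fun_prop :
    Measurable fun g : ℝ => h + g * a)).pow_const 2).aestronglyMeasurable 1 (ae_of_all _ fun g => ?_)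
  rw [Real.norm_eq_abs, abs_pow]
  exact pow_le_one₀ (abs_nonneg _) (abs_dphi_le_one hμ _ _)

theorem qlin_mem_Icc (hμ : ∀ᵐ s ∂μ, s ∈ Set.Icc (-1 : ℝ) 1) (h x : ℝ) :
    qlin μ h x ∈ Set.Icc (0 : ℝ) 1 := by
  refine ⟨integral_nonneg fun _ => sq_nonneg _, integral_le_of_forall_le_const zero_le_one
    fun g => ?_⟩
  rw [← sq_abs]
  exact pow_le_one₀ (abs_nonneg _) (abs_dphi_le_one hμ _ _)

theorem integrable_phi (hμ : ∀ᵐ s ∂μ, s ∈ Set.Icc (-1 : ℝ) 1) (h a v : ℝ) :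
    Integrable (fun g => phi μ (h + g * a) v) (gaussianReal 0 1) := by
  have hb : Integrable (fun g : ℝ => |h| + |g| * |a| + |v|) (gaussianReal 0 1) :=
    ((integrable_const _).add (integrable_abs_gaussian.mul_const _)).add (integrable_const _)
  refine hb.mono' ((measurable_phi v).comp (by fun_prop :
    Measurable fun g : ℝ => h + g * a)).aestronglyMeasurable (ae_of_all _ fun g => ?_)
  refine (abs_phi_le hμ _ _).trans (add_le_add ((abs_add_le _ _).trans ?_) le_rfl)
  rw [abs_mul]

/-- Keeping the term linear in `y` exact lets it vanish on averaging a centered variable, leaving a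
sub-Gaussian bound. For `|y| ≤ 1` it follows from `exp y ≤ 1 + y + y²`. -/
theorem exp_le_add_exp_sq (y : ℝ) : Real.exp y ≤ y + Real.exp (y ^ 2) := by
  have h1 := Real.add_one_le_exp (y ^ 2)
  rcases le_or_gt |y| 1 with h | h
  · have := (abs_le.1 (Real.abs_exp_sub_one_sub_id_le h)).2
    linarith
  · rcases le_or_gt 0 y with h0 | h0
    · rw [abs_of_nonneg h0] at h
      have : Real.exp y ≤ Real.exp (y ^ 2) := Real.exp_le_exp.2 (by nlinarith)
      linarith
    · rw [abs_of_neg h0] at h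
      have : Real.exp y ≤ 1 := Real.exp_le_one_iff.2 h0.le
      nlinarith

/-- The mean of `σ τ` over two replicas is the square of the mean spin `dphi`, and `|σ τ - q| ≤ 2`
gives the exponent `4c²`. -/
theorem siteMGF_le (hμ : ∀ᵐ s ∂μ, s ∈ Set.Icc (-1 : ℝ) 1) {q : ℝ} (hq : q ∈ Set.Icc (0 : ℝ) 1)
    (u v c : ℝ) : siteMGF μ q u v c ≤ c * (dphi μ u v ^ 2 - q) + Real.exp (4 * c ^ 2) := by
  have hW : Measurable fun r : ℝ × ℝ => siteEnergy u v r.1 + siteEnergy u v r.2 := by fun_prop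
  have hb := ae_abs_siteEnergy_add_le hμ u v
  have := isProbabilityMeasure_tilted_of_bdd hW hb
  have hac := tilted_absolutelyContinuous (μ.prod μ)
    fun r => siteEnergy u v r.1 + siteEnergy u v r.2
  have hX : ∀ᵐ r ∂((μ.prod μ).tilted fun r => siteEnergy u v r.1 + siteEnergy u v r.2),
      |r.1 * r.2 - q| ≤ 2 := hac.ae_le (ae_abs_mul_sub_le hμ hq)
  have iX : Integrable (fun r : ℝ × ℝ => r.1 * r.2 - q)
      ((μ.prod μ).tilted fun r => siteEnergy u v r.1 + siteEnergy u v r.2) :=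
    Integrable.of_bound (by fun_prop) 2 hX
  have iX' : Integrable (fun r : ℝ × ℝ => r.1 * r.2)
      ((μ.prod μ).tilted fun r => siteEnergy u v r.1 + siteEnergy u v r.2) := by
    exact (iX.add (integrable_const q)).congr (ae_of_all _ fun r => by simp)
  have e : ∫ r, (c * (r.1 * r.2 - q) + Real.exp (4 * c ^ 2))
      ∂((μ.prod μ).tilted fun r => siteEnergy u v r.1 + siteEnergy u v r.2)
      = c * (dphi μ u v ^ 2 - q) + Real.exp (4 * c ^ 2) := by
    rw [integral_add (iX.const_mul c) (integrable_const _), integral_const_mul,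
      integral_sub iX' (integrable_const _), ← integral_tilted_mul_integral_tilted
      (fun s => siteEnergy u v s) (fun s => s) (fun s => siteEnergy u v s) (fun s => s)]
    simp only [integral_const, probReal_univ, one_smul, sq]
    rw [dphi_eq hμ]
  rw [← e]
  refine integral_mono_ae ?_ ((iX.const_mul c).add (integrable_const _)) ?_
  · refine Integrable.of_bound (by fun_prop) (Real.exp (|c| * 2)) (hX.mono fun r hr => ?_)
    rw [Real.norm_eq_abs, Real.abs_exp]
    refine Real.exp_le_exp.2 ((le_abs_self _).trans ?_)
    rw [abs_mul]
    gcongr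
  · filter_upwards [hX] with r hr
    refine (exp_le_add_exp_sq _).trans (by
      gcongr
      rw [mul_pow, ← sq_abs (r.1 * r.2 - q)]
      nlinarith [sq_nonneg c, abs_nonneg (r.1 * r.2 - q), mul_nonneg (sq_nonneg c)
        (by nlinarith [abs_nonneg (r.1 * r.2 - q)] : 0 ≤ 4 - |r.1 * r.2 - q| ^ 2)])

/-- The fixed point equation enters here: it says precisely that the linear term has mean zero over
the Gaussian field. -/
theorem integral_siteMGF_le (hμ : ∀ᵐ s ∂μ, s ∈ Set.Icc (-1 : ℝ) 1) {h q t : ℝ}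
    (hfix : qlin μ h (2 * q * t) = q) (c : ℝ) :
    ∫ x, siteMGF μ q (h + x * √(2 * q * t)) (-(q * t)) c ∂(gaussianReal 0 1)
      ≤ Real.exp (4 * c ^ 2) := by
  have hq1 : q ∈ Set.Icc (0 : ℝ) 1 := hfix ▸ qlin_mem_Icc hμ h (2 * q * t)
  have hi := integrable_dphi_sq hμ h √(2 * q * t) (-(q * t))
  have e : ∫ x, (c * (dphi μ (h + x * √(2 * q * t)) (-(q * t)) ^ 2 - q) + Real.exp (4 * c ^ 2))
      ∂(gaussianReal 0 1) = Real.exp (4 * c ^ 2) := by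
    have hi' : Integrable (fun x => dphi μ (h + x * √(2 * q * t)) (-(q * t)) ^ 2 - q)
        (gaussianReal 0 1) := hi.sub (integrable_const q)
    rw [integral_add (hi'.const_mul c) (integrable_const _),
      integral_const_mul, integral_sub hi (integrable_const _)]
    have : ∫ x, dphi μ (h + x * √(2 * q * t)) (-(q * t)) ^ 2 ∂(gaussianReal 0 1) = q := by
      refine Eq.trans ?_ hfix
      unfold qlin
      rw [show -(2 * q * t) / 2 = -(q * t) by ring]
    rw [this]
    simp
  rw [← e]
  exact integral_mono_of_nonneg (ae_of_all _ fun x => siteMGF_nonneg _ _ _ _)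
    (((hi.sub (integrable_const q)).const_mul c).add (integrable_const _))
    (ae_of_all _ fun x => siteMGF_le hμ hq1 _ _ _)

end SingleSite

end GeneralSpinSK

namespace GeneralSpinSK

/-! ### The two ends of the path. -/

section Endpoints

variable {μ : Measure ℝ} [IsProbabilityMeasure μ] {n : ℕ} (h : ℝ) {t q : ℝ}
  (hμ : ∀ᵐ s ∂μ, s ∈ Set.Icc (-1 : ℝ) 1) (ht : 0 ≤ t) (hq : 0 ≤ q)

theorem singlePath_energy_pi_div_two (g : (Fin n × Fin n) ⊕ Fin n → ℝ) (σ : Fin n → ℝ) :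
    (singlePath h n hμ ht hq).energy (Real.pi / 2) g σ
      = √t * hamiltonian (fun p => g (Sum.inl p)) σ + h * ∑ i, σ i
        - t / 2 * n * overlap σ σ ^ 2 := by
  rw [← sum_feature_eq_hamiltonian, Finset.mul_sum]
  simp only [EnergyPath.energy, singlePath, pathCoef, drift, Fintype.sum_sum_type, Sum.elim_inl,
    Sum.elim_inr, Real.sin_pi_div_two, Real.cos_pi_div_two]
  have : ∀ p : Fin n × Fin n, g (Sum.inl p) * (√t * 1) * feature (Sum.inl p) σ
      = √t * (g (Sum.inl p) * feature (Sum.inl p) σ) := fun p => by ring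
  simp only [this]
  simp
  ring

theorem singlePath_energy_zero (g : (Fin n × Fin n) ⊕ Fin n → ℝ) (σ : Fin n → ℝ) :
    (singlePath h n hμ ht hq).energy 0 g σ
      = ∑ i, siteEnergy (h + g (Sum.inr i) * √(2 * q * t)) (-(q * t)) (σ i) := by
  have h1 := sum_feature_inr_mul σ σ
  simp only [feature, Sum.elim_inr] at h1
  have h2 : q * t * n * overlap σ σ = q * t * ∑ i, σ i * σ i := by rw [h1]; ring
  simp only [EnergyPath.energy, singlePath, pathCoef, drift, Fintype.sum_sum_type, Sum.elim_inl,
    Sum.elim_inr, Real.sin_zero, Real.cos_zero, feature, siteEnergy]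
  rw [h2]
  simp only [add_mul, Finset.sum_add_distrib, ← Finset.mul_sum]
  have h3 : ∑ i, σ i ^ 2 = ∑ i, σ i * σ i := Finset.sum_congr rfl fun i _ => sq _
  rw [h3]
  simp
  ring

theorem logZ_singlePath_zero :
    (singlePath h n hμ ht hq).logZ 0
      = n * ∫ g, phi μ (h + g * √(2 * q * t)) (-(q * t)) ∂(gaussianReal 0 1) := by
  unfold EnergyPath.logZ
  have e : ∀ g : (Fin n × Fin n) ⊕ Fin n → ℝ,
      Real.log (∫ σ, Real.exp ((singlePath h n hμ ht hq).energy 0 g σ)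
        ∂(Measure.pi fun _ : Fin n => μ))
      = ∑ i : Fin n, phi μ (h + g (Sum.inr i) * √(2 * q * t)) (-(q * t)) := by
    intro g
    simp only [singlePath_energy_zero, Real.exp_sum]
    rw [integral_fintype_prod_eq_prod (fun (i : Fin n) (s : ℝ) =>
      Real.exp (siteEnergy (h + g (Sum.inr i) * √(2 * q * t)) (-(q * t)) s)), Real.log_prod]
    · rfl
    · intro i _
      exact (integral_exp_pos_of_bdd (by fun_prop) (ae_abs_siteEnergy_le hμ _ _)).ne'
  simp only [e]
  have hi := integrable_phi hμ h √(2 * q * t) (-(q * t))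
  rw [integral_finsetSum _ fun i _ => integrable_comp_eval
    (μ := fun _ : (Fin n × Fin n) ⊕ Fin n => gaussianReal 0 1) (i := Sum.inr i) hi]
  have e2 : ∀ i : Fin n, ∫ g, phi μ (h + g (Sum.inr i) * √(2 * q * t)) (-(q * t))
      ∂(Measure.pi fun _ : (Fin n × Fin n) ⊕ Fin n => gaussianReal 0 1)
      = ∫ g, phi μ (h + g * √(2 * q * t)) (-(q * t)) ∂(gaussianReal 0 1) := fun i =>
    integral_comp_eval (μ := fun _ : (Fin n × Fin n) ⊕ Fin n => gaussianReal 0 1) (i := Sum.inr i)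
      hi.aestronglyMeasurable
  simp [e2]

theorem measurable_hamiltonian :
    Measurable fun p : (Fin n × Fin n → ℝ) × (Fin n → ℝ) => hamiltonian p.1 p.2 := by
  unfold hamiltonian
  fun_prop

theorem measurable_log_partitionFunction :
    Measurable fun g => Real.log (partitionFunction μ h t n g) := by
  refine measurable_log_integral_exp (m := Measure.pi fun _ : Fin n => μ)
    (W := fun g σ => √t * hamiltonian g σ + h * ∑ i, σ i - t / 2 * n * overlap σ σ ^ 2) ?_
  have := measurable_hamiltonian (n := n)
  unfold Function.uncurry
  fun_prop

theorem log_partitionFunction_comp_inl (g : (Fin n × Fin n) ⊕ Fin n → ℝ) :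
    Real.log (partitionFunction μ h t n fun p => g (Sum.inl p))
      = Real.log (∫ σ, Real.exp ((singlePath h n hμ ht hq).energy (Real.pi / 2) g σ)
        ∂(Measure.pi fun _ : Fin n => μ)) := by
  simp only [singlePath_energy_pi_div_two]
  rfl

theorem integrable_log_partitionFunction (hμ : ∀ᵐ s ∂μ, s ∈ Set.Icc (-1 : ℝ) 1) (ht : 0 ≤ t) :
    Integrable (fun g => Real.log (partitionFunction μ h t n g)) (disorder n) := by
  refine ((measurePreserving_comp_inl (ι := Fin n × Fin n) (ι' := Fin n)
    (gaussianReal 0 1)).integrable_comp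
    (measurable_log_partitionFunction h).aestronglyMeasurable).1 ?_
  -- At `θ = π/2` the energy does not involve `q`, so the path with `q = 0` serves.
  refine ((singlePath h n hμ ht le_rfl).integrable_log (Real.pi / 2)).congr (ae_of_all _ fun g => ?_)
  exact (log_partitionFunction_comp_inl h hμ ht le_rfl g).symm

theorem logZ_singlePath_pi_div_two :
    (singlePath h n hμ ht hq).logZ (Real.pi / 2)
      = ∫ g, Real.log (partitionFunction μ h t n g) ∂(disorder n) := by
  have hmp := measurePreserving_comp_inl (ι := Fin n × Fin n) (ι' := Fin n) (gaussianReal 0 1)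
  unfold EnergyPath.logZ disorder
  simp only [← log_partitionFunction_comp_inl]
  rw [← hmp.map_eq, integral_map hmp.measurable.aemeasurable
    (measurable_log_partitionFunction h).aestronglyMeasurable]

end Endpoints

/-! ### Cost of the replica coupling at the decoupled end. -/

section Decoupled

variable {μ : Measure ℝ} [IsProbabilityMeasure μ] {n : ℕ} (h : ℝ) {t q : ℝ}
  (hμ : ∀ᵐ s ∂μ, s ∈ Set.Icc (-1 : ℝ) 1) (ht : 0 ≤ t) (hq : 0 ≤ q)

theorem pairPath_zero_energy_zero (g : (Fin n × Fin n) ⊕ Fin n → ℝ)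
    (p : (Fin n → ℝ) × (Fin n → ℝ)) :
    (pairPath h n hμ ht hq 0 0).energy 0 g p
      = ∑ i, (siteEnergy (h + g (Sum.inr i) * √(2 * q * t)) (-(q * t)) (p.1 i)
        + siteEnergy (h + g (Sum.inr i) * √(2 * q * t)) (-(q * t)) (p.2 i)) := by
  simp only [pairPath_zero_energy, singlePath_energy_zero, Finset.sum_add_distrib]

theorem gibbs_exp_sum_eq_prod (g : (Fin n × Fin n) ⊕ Fin n → ℝ) (c : ℝ) :
    ∫ p, Real.exp (c * ∑ i, (p.1 i * p.2 i - q))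
      ∂(((Measure.pi fun _ : Fin n => μ).prod (Measure.pi fun _ : Fin n => μ)).tilted
        ((pairPath h n hμ ht hq 0 0).energy 0 g))
      = ∏ i : Fin n, siteMGF μ q (h + g (Sum.inr i) * √(2 * q * t)) (-(q * t)) c := by
  unfold siteMGF
  simp only [integral_tilted_eq_div, Finset.prod_div_distrib]
  rw [← integral_prod_pi_pi, ← integral_prod_pi_pi]
  simp only [pairPath_zero_energy_zero, Real.exp_sum, Finset.mul_sum, Finset.prod_mul_distrib]

theorem integral_gibbs_exp_sum_le (hfix : qlin μ h (2 * q * t) = q) (c : ℝ) :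
    ∫ g, ∫ p, Real.exp (c * ∑ i, (p.1 i * p.2 i - q))
      ∂(((Measure.pi fun _ : Fin n => μ).prod (Measure.pi fun _ : Fin n => μ)).tilted
        ((pairPath h n hμ ht hq 0 0).energy 0 g))
      ∂(Measure.pi fun _ : (Fin n × Fin n) ⊕ Fin n => gaussianReal 0 1)
      ≤ Real.exp (n * (4 * c ^ 2)) := by
  simp only [gibbs_exp_sum_eq_prod]
  -- The constant factor one is inserted for the couplings, which are absent at `θ = 0`, so that the
  -- expectation factorises over all Gaussian variables.
  have e : ∀ g : (Fin n × Fin n) ⊕ Fin n → ℝ,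
      ∏ i : Fin n, siteMGF μ q (h + g (Sum.inr i) * √(2 * q * t)) (-(q * t)) c
      = ∏ k : (Fin n × Fin n) ⊕ Fin n, (Sum.elim (fun _ _ => 1)
        (fun _ x => siteMGF μ q (h + x * √(2 * q * t)) (-(q * t)) c) k : ℝ → ℝ) (g k) := by
    intro g
    rw [Fintype.prod_sum_type]
    simp
  simp only [e]
  rw [integral_fintype_prod_eq_prod, Fintype.prod_sum_type]
  simp only [Sum.elim_inl, Sum.elim_inr, integral_const, probReal_univ, one_smul,
    Finset.prod_const, one_pow, one_mul, Finset.card_univ, Fintype.card_fin]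
  rw [Real.exp_nat_mul]
  exact pow_le_pow_left₀ (integral_nonneg fun x => siteMGF_nonneg _ _ _ _)
    (integral_siteMGF_le hμ hfix c) n

theorem integrable_exp_sq_div_four :
    Integrable (fun z : ℝ => Real.exp (z ^ 2 / 4)) (gaussianReal 0 1) := by
  rw [gaussianReal_of_var_ne_zero _ one_ne_zero,
    integrable_withDensity_iff (measurable_gaussianPDF 0 1)
      (ae_of_all _ fun x => gaussianPDF_lt_top)]
  refine ((integrable_exp_neg_mul_sq (b := 1 / 4) (by norm_num)).const_mul
    (√(2 * Real.pi * (1 : NNReal)))⁻¹).congr (ae_of_all _ fun x => ?_)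
  simp only [toReal_gaussianPDF, gaussianPDFReal_def, NNReal.coe_one, sub_zero, mul_one]
  rw [mul_left_comm, ← Real.exp_add]
  ring_nf

theorem integrable_exp_mul_abs_gaussian (B : ℝ) :
    Integrable (fun z : ℝ => Real.exp (B * |z|)) (gaussianReal 0 1) := by
  refine ((integrable_exp_mul_gaussianReal B).add (integrable_exp_mul_gaussianReal (-B))).mono'
    (by fun_prop) (ae_of_all _ fun z => ?_)
  rw [Real.norm_eq_abs, Real.abs_exp, Pi.add_apply]
  rcases le_total 0 z with hz | hz
  · rw [abs_of_nonneg hz]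
    exact le_add_of_nonneg_right (Real.exp_pos _).le
  · rw [abs_of_nonpos hz, mul_neg, ← neg_mul]
    exact le_add_of_nonneg_left (Real.exp_pos _).le

/-- The Hubbard–Stratonovich identity, which linearises the squared overlap so that the sites
factorise. -/
theorem exp_half_sq_eq_integral (y : ℝ) :
    Real.exp (y ^ 2 / 2) = ∫ z, Real.exp (y * z) ∂(gaussianReal 0 1) := by
  have := congrFun (mgf_id_gaussianReal (μ := 0) (v := 1)) y
  simp only [mgf, id] at this
  rw [this]
  simp

/-- At the decoupled end of the path, the overlap fluctuates on the scale `n^{-1/2}`. -/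
theorem integral_gibbs_exp_sq_overlap_le (hn : 0 < n) (hfix : qlin μ h (2 * q * t) = q) :
    ∫ g, ∫ p, Real.exp (1 / 16 * (n / 2 * (overlap p.1 p.2 - q) ^ 2))
      ∂(((Measure.pi fun _ : Fin n => μ).prod (Measure.pi fun _ : Fin n => μ)).tilted
        ((pairPath h n hμ ht hq 0 0).energy 0 g))
      ∂(Measure.pi fun _ : (Fin n × Fin n) ⊕ Fin n => gaussianReal 0 1)
      ≤ ∫ z, Real.exp (z ^ 2 / 4) ∂(gaussianReal 0 1) := by
  have hn' : (0 : ℝ) < n := by exact_mod_cast hn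
  set P := pairPath h n hμ ht hq 0 0 with hP
  have hq1 : q ∈ Set.Icc (0 : ℝ) 1 := hfix ▸ qlin_mem_Icc hμ h (2 * q * t)
  -- With `X = n(R₁₂ - q)` this makes `(κX)²/2` the coupling term. The site bound with `c = κz` then
  -- gives `n · 4κ²z² = z²/4`, still integrable against the Gaussian; hence the choice `Λ = 1/16`.
  obtain ⟨κ, hκ⟩ : ∃ κ : ℝ, κ ^ 2 = 1 / 16 / n := ⟨√(1 / 16 / n), Real.sq_sqrt (by positivity)⟩
  let X : (Fin n → ℝ) × (Fin n → ℝ) → ℝ := fun p => ∑ i, (p.1 i * p.2 i - q)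
  have hXm : Measurable X := by unfold X; fun_prop
  have hX : ∀ p, X p = n * (overlap p.1 p.2 - q) := by
    intro p
    simp only [X, overlap, Finset.sum_sub_distrib, Finset.sum_const, Finset.card_univ,
      Fintype.card_fin, nsmul_eq_mul]
    field_simp
  have hXb : ∀ᵐ p ∂((Measure.pi fun _ : Fin n => μ).prod (Measure.pi fun _ : Fin n => μ)),
      |X p| ≤ n * (1 + q) := by
    filter_upwards [ae_abs_le_one_prod hμ] with p hp
    rw [hX, abs_mul, abs_of_pos hn']
    gcongr
    refine (abs_sub _ _).trans ?_
    rw [abs_of_nonneg hq]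
    exact add_le_add (abs_overlap_le hp.1 hp.2) le_rfl
  set B := |κ| * (n * (1 + q)) with hB
  have hXz : ∀ g, ∀ᵐ p ∂(((Measure.pi fun _ : Fin n => μ).prod
      (Measure.pi fun _ : Fin n => μ)).tilted (P.energy 0 g)), ∀ z : ℝ,
      |Real.exp (κ * X p * z)| ≤ Real.exp (B * |z|) := by
    intro g
    have := (tilted_absolutelyContinuous _ (P.energy 0 g)).ae_le hXb
    filter_upwards [this] with p hp z
    rw [Real.abs_exp]
    refine Real.exp_le_exp.2 ((le_abs_self _).trans ?_)
    rw [abs_mul, abs_mul, hB]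
    gcongr
  have hprob : ∀ g, IsProbabilityMeasure (((Measure.pi fun _ : Fin n => μ).prod
      (Measure.pi fun _ : Fin n => μ)).tilted (P.energy 0 g)) := fun g =>
    isProbabilityMeasure_tilted_of_bdd (P.measurable_energy 0 g) (P.abs_energy_le' 0 g)
  let J : ((Fin n × Fin n) ⊕ Fin n → ℝ) → ℝ → ℝ := fun g z => ∫ p, Real.exp (κ * X p * z)
    ∂(((Measure.pi fun _ : Fin n => μ).prod (Measure.pi fun _ : Fin n => μ)).tilted (P.energy 0 g))
  have hJm : Measurable (Function.uncurry J) := by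
    refine measurable_integral_tilted
      (W := fun (x : ((Fin n × Fin n) ⊕ Fin n → ℝ) × ℝ) p => P.energy 0 x.1 p)
      (f := fun (x : ((Fin n × Fin n) ⊕ Fin n → ℝ) × ℝ) p => Real.exp (κ * X p * x.2)) ?_ ?_
    · exact (P.measurable_energy_uncurry 0).comp
        ((measurable_fst.comp measurable_fst).prodMk measurable_snd)
    · unfold Function.uncurry
      fun_prop
  have hJb : ∀ g z, |J g z| ≤ Real.exp (B * |z|) := by
    intro g z
    have := hprob g
    have := norm_integral_le_of_norm_le_const (f := fun p => Real.exp (κ * X p * z))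
      ((hXz g).mono fun p hp => hp z)
    simpa using this
  have e1 : ∀ g, ∫ p, Real.exp (1 / 16 * (n / 2 * (overlap p.1 p.2 - q) ^ 2))
      ∂(((Measure.pi fun _ : Fin n => μ).prod (Measure.pi fun _ : Fin n => μ)).tilted
        (P.energy 0 g)) = ∫ z, J g z ∂(gaussianReal 0 1) := by
    intro g
    have := hprob g
    have e : ∀ p : (Fin n → ℝ) × (Fin n → ℝ),
        Real.exp (1 / 16 * (n / 2 * (overlap p.1 p.2 - q) ^ 2))
        = ∫ z, Real.exp (κ * X p * z) ∂(gaussianReal 0 1) := by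
      intro p
      rw [← exp_half_sq_eq_integral, mul_pow, hκ, hX]
      congr 1
      field_simp
    simp only [e]
    refine integral_integral_swap (((integrable_const (1 : ℝ)).mul_prod
      (integrable_exp_mul_abs_gaussian B)).mono' ?_ ?_)
    · exact Measurable.aestronglyMeasurable (by unfold Function.uncurry; fun_prop)
    · filter_upwards [Measure.quasiMeasurePreserving_fst.ae (hXz g)] with x hx
      rw [one_mul]
      exact hx x.2
  simp only [e1]
  -- With the auxiliary variable `z` moved outside, the disorder average at fixed `z` is the
  -- factorised exponential moment.
  rw [integral_integral_swap (((integrable_const (1 : ℝ)).mul_prod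
      (integrable_exp_mul_abs_gaussian B)).mono' hJm.aestronglyMeasurable
      (ae_of_all _ fun x => by rw [one_mul]; exact hJb x.1 x.2))]
  refine integral_mono_of_nonneg (ae_of_all _ fun z => integral_nonneg fun g =>
    integral_nonneg fun p => (Real.exp_pos _).le) integrable_exp_sq_div_four
    (ae_of_all _ fun z => ?_)
  have := integral_gibbs_exp_sum_le h hμ ht hq hfix (κ * z) (n := n)
  refine le_trans (le_of_eq ?_) (this.trans (le_of_eq ?_))
  · simp only [J, X, mul_right_comm κ _ z]
    rfl
  · rw [mul_pow, hκ]
    congr 1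
    field_simp
    ring

/-- The ratio of the coupled to the uncoupled partition function is a Gibbs exponential moment, and
`log x ≤ x - 1` bounds its log by that moment. The rate `r` plays no role because `sin 0 = 0`. -/
theorem logZ_pairPath_zero_le (hn : 0 < n) (hfix : qlin μ h (2 * q * t) = q) (r : ℝ) :
    (pairPath h n hμ ht hq (1 / 16) r).logZ 0 ≤ 2 * (singlePath h n hμ ht hq).logZ 0
      + ∫ z, Real.exp (z ^ 2 / 4) ∂(gaussianReal 0 1) := by
  have hI := integral_gibbs_exp_sq_overlap_le h hμ ht hq hn hfix
  have hYm : Measurable fun p : (Fin n → ℝ) × (Fin n → ℝ) =>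
      1 / 16 * (n / 2 * (overlap p.1 p.2 - q) ^ 2) := by fun_prop
  have hYb : ∀ᵐ p ∂((Measure.pi fun _ : Fin n => μ).prod (Measure.pi fun _ : Fin n => μ)),
      |1 / 16 * (n / 2 * (overlap p.1 p.2 - q) ^ 2)| ≤ 1 / 16 * (n / 2 * (1 + q) ^ 2) :=
    (ae_sq_overlap_sub_le hμ hq).mono fun p hp => by
      rw [abs_mul, abs_mul, abs_of_nonneg (by positivity : 0 ≤ (1 : ℝ) / 16),
        abs_of_nonneg (by positivity : 0 ≤ (n : ℝ) / 2)]
      gcongr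
  set P := pairPath h n hμ ht hq 0 0 with hP
  have hi := P.integrable_gibbs 0 hYm.exp (C := Real.exp (1 / 16 * (n / 2 * (1 + q) ^ 2)))
    (hYb.mono fun p hp => by
      rw [Real.abs_exp]
      exact Real.exp_le_exp.2 ((le_abs_self _).trans hp))
  have hs := ((singlePath h n hμ ht hq).integrable_log 0).const_mul 2
  refine le_trans ?_ (add_le_add_right hI _)
  unfold EnergyPath.logZ
  rw [← integral_const_mul, ← integral_add hs hi]
  refine integral_mono ((pairPath h n hμ ht hq (1 / 16) r).integrable_log 0) (hs.add hi) fun g => ?_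
  rw [← log_integral_exp_pairPath_zero, ← hP]
  have hp0 := integral_exp_pos_of_bdd (P.measurable_energy 0 g) (P.abs_energy_le' 0 g)
  have hp1 := integral_exp_pos_of_bdd
    ((pairPath h n hμ ht hq (1 / 16) r).measurable_energy 0 g)
    ((pairPath h n hμ ht hq (1 / 16) r).abs_energy_le' 0 g)
  have e : ∀ p, Real.exp (1 / 16 * (n / 2 * (overlap p.1 p.2 - q) ^ 2)) * Real.exp (P.energy 0 g p)
      = Real.exp ((pairPath h n hμ ht hq (1 / 16) r).energy 0 g p) := by
    intro p
    rw [← Real.exp_add, hP, pairPath_energy, pairPath_energy]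
    simp [add_comm]
  rw [integral_tilted_eq_div]
  simp only [e]
  have := Real.log_le_sub_one_of_pos (div_pos hp1 hp0)
  rw [Real.log_div hp1.ne' hp0.ne'] at this
  linarith

end Decoupled

end GeneralSpinSK

namespace GeneralSpinSK

/-! ### Existence and uniqueness for the fixed point equation. -/

section FixedPoint

variable {μ : Measure ℝ} [IsProbabilityMeasure μ]

theorem continuous_integral_mul_exp_siteEnergy (hμ : ∀ᵐ s ∂μ, s ∈ Set.Icc (-1 : ℝ) 1)
    {f : ℝ → ℝ} (hf : Measurable f) (hf1 : ∀ᵐ s ∂μ, |f s| ≤ 1) :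
    Continuous fun p : ℝ × ℝ => ∫ s, f s * Real.exp (siteEnergy p.1 p.2 s) ∂μ := by
  refine continuous_iff_continuousAt.2 fun p₀ => ?_
  refine continuousAt_of_dominated (bound := fun _ => Real.exp ((|p₀.1| + 1) + (|p₀.2| + 1)))
    (Eventually.of_forall fun p => (hf.mul (by fun_prop)).aestronglyMeasurable) ?_
    (integrable_const _) ?_
  · have h1 : ∀ᶠ p : ℝ × ℝ in 𝓝 p₀, |p.1| < |p₀.1| + 1 :=
      (continuous_fst.abs.tendsto p₀).eventually_lt_const (lt_add_one _)
    have h2 : ∀ᶠ p : ℝ × ℝ in 𝓝 p₀, |p.2| < |p₀.2| + 1 :=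
      (continuous_snd.abs.tendsto p₀).eventually_lt_const (lt_add_one _)
    filter_upwards [h1, h2] with p hp1 hp2
    filter_upwards [hμ, hf1] with s hs hfs
    rw [Real.norm_eq_abs, abs_mul, Real.abs_exp, ← one_mul (Real.exp (|p₀.1| + 1 + (|p₀.2| + 1)))]
    gcongr
    exact (le_abs_self _).trans ((abs_siteEnergy_le p.1 p.2 (abs_le.2 hs)).trans
      (add_le_add hp1.le hp2.le))
  · refine ae_of_all _ fun s => Continuous.continuousAt ?_
    unfold siteEnergy
    fun_prop

theorem continuous_dphi (hμ : ∀ᵐ s ∂μ, s ∈ Set.Icc (-1 : ℝ) 1) :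
    Continuous fun p : ℝ × ℝ => dphi μ p.1 p.2 := by
  simp only [dphi_eq hμ, integral_tilted_eq_div]
  refine (continuous_integral_mul_exp_siteEnergy hμ measurable_id
    (hμ.mono fun _ hs => abs_le.2 hs)).div ?_ fun p => ?_
  · simpa using continuous_integral_mul_exp_siteEnergy hμ
      (measurable_const : Measurable fun _ : ℝ => (1 : ℝ)) (by simp)
  · exact (integral_exp_pos_of_bdd (by fun_prop) (ae_abs_siteEnergy_le hμ p.1 p.2)).ne'

theorem continuous_qlin (hμ : ∀ᵐ s ∂μ, s ∈ Set.Icc (-1 : ℝ) 1) (h : ℝ) :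
    Continuous (qlin μ h) := by
  refine continuous_of_dominated (bound := fun _ => 1) (fun x => ?_) (fun x => ae_of_all _ fun g => ?_)
    (integrable_const _) (ae_of_all _ fun g => ?_)
  · exact (integrable_dphi_sq hμ h √x (-x / 2)).aestronglyMeasurable
  · rw [Real.norm_eq_abs, abs_pow]
    exact pow_le_one₀ (abs_nonneg _) (abs_dphi_le_one hμ _ _)
  · exact ((continuous_dphi hμ).comp (by fun_prop :
      Continuous fun x : ℝ => (h + g * √x, -x / 2))).pow 2

/-- A continuous self-map of `[0, 1]` has a fixed point; the values stay there because `|dphi| ≤ 1`.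
-/
theorem exists_qlin_eq (hμ : ∀ᵐ s ∂μ, s ∈ Set.Icc (-1 : ℝ) 1) (h t : ℝ) :
    ∃ q, 0 ≤ q ∧ qlin μ h (2 * q * t) = q := by
  obtain ⟨q, hq, hfix⟩ := exists_mem_Icc_isFixedPt (f := fun q => qlin μ h (2 * q * t))
    (a := 0) (b := 1) ((continuous_qlin hμ h).comp (by fun_prop)).continuousOn zero_le_one
    (qlin_mem_Icc hμ h _).1 (qlin_mem_Icc hμ h _).2
  exact ⟨q, hq.1, hfix⟩

/-- At the SK end of the path the Gibbs measure does not depend on `q`, so the overlap cannot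
concentrate at two different values. -/
theorem sq_sub_le_overlapVar_add {n : ℕ} (h : ℝ) {t q q' : ℝ}
    (hμ : ∀ᵐ s ∂μ, s ∈ Set.Icc (-1 : ℝ) 1) (ht : 0 ≤ t) (hq : 0 ≤ q) (hq' : 0 ≤ q') :
    (q' - q) ^ 2 ≤ 2 * overlapVar h hμ ht hq n (Real.pi / 2)
      + 2 * overlapVar h hμ ht hq' n (Real.pi / 2) := by
  have e : ∀ g : (Fin n × Fin n) ⊕ Fin n → ℝ,
      (pairPath h n hμ ht hq' 0 0).energy (Real.pi / 2) g
        = (pairPath h n hμ ht hq 0 0).energy (Real.pi / 2) g := by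
    intro g
    simp only [pairPath_zero_energy, singlePath_energy_pi_div_two]
  unfold overlapVar
  have i1 := (integrable_gibbs_sq_overlap_sub (n := n) h hμ ht hq (Real.pi / 2)).const_mul 2
  have i2 := (integrable_gibbs_sq_overlap_sub (n := n) h hμ ht hq' (Real.pi / 2)).const_mul 2
  rw [← integral_const_mul, ← integral_const_mul, ← integral_add i1 i2]
  have hc : (q' - q) ^ 2 = ∫ _g : (Fin n × Fin n) ⊕ Fin n → ℝ, (q' - q) ^ 2
      ∂(Measure.pi fun _ => gaussianReal 0 1) := by simp
  rw [hc]
  refine integral_mono (integrable_const _) (i1.add i2) fun g => ?_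
  have := isProbabilityMeasure_tilted_of_bdd
    ((pairPath h n hμ ht hq 0 0).measurable_energy (Real.pi / 2) g)
    ((pairPath h n hμ ht hq 0 0).abs_energy_le' (Real.pi / 2) g)
  have j1 := ((pairPath h n hμ ht hq 0 0).integrable_tilted (Real.pi / 2) g
      (measurable_sq_overlap_sub (q := q)) (ae_sq_overlap_sub_le hμ hq)).const_mul 2
  have j2 := ((pairPath h n hμ ht hq 0 0).integrable_tilted (Real.pi / 2) g
      (measurable_sq_overlap_sub (q := q')) (ae_sq_overlap_sub_le hμ hq')).const_mul 2
  simp only [e]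
  rw [← integral_const_mul, ← integral_const_mul, ← integral_add j1 j2]
  simpa using integral_mono (integrable_const ((q' - q) ^ 2)) (j1.add j2) fun p => by
    simp only [Pi.add_apply]
    nlinarith [sq_nonneg ((overlap p.1 p.2 - q) + (overlap p.1 p.2 - q'))]

end FixedPoint

theorem tendsto_const_div_natCast (C : ℝ) : Tendsto (fun n : ℕ => C / (n : ℝ)) atTop (𝓝 0) :=
  tendsto_const_nhds.div_atTop tendsto_natCast_atTop_atTop

end GeneralSpinSK

/-! ### The limit of the free energy. -/

theorem mainTheorem1 :
    ∃ tc : ℝ, 0 < tc ∧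
      ∀ μ : Measure ℝ, IsProbabilityMeasure μ →
        (∀ᵐ s ∂μ, s ∈ Set.Icc (-1 : ℝ) 1) →
        Measure.map (fun s : ℝ => -s) μ = μ →
        ∀ h t : ℝ, 0 ≤ t → t ≤ tc →
          (∀ n : ℕ, Integrable
            (fun g => Real.log (GeneralSpinSK.partitionFunction μ h t n g))
            (GeneralSpinSK.disorder n)) ∧
          ∃ q : ℝ, (0 ≤ q ∧ GeneralSpinSK.qlin μ h (2 * q * t) = q) ∧
            (∀ q' : ℝ, 0 ≤ q' → GeneralSpinSK.qlin μ h (2 * q' * t) = q' → q' = q) ∧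
            Integrable
              (fun g => GeneralSpinSK.phi μ (h + g * Real.sqrt (2 * q * t)) (-(q * t)))
              (gaussianReal 0 1) ∧
            Tendsto (fun n : ℕ => GeneralSpinSK.freeEnergy μ h t n) atTop
              (𝓝 (t / 2 * q ^ 2 +
                ∫ g, GeneralSpinSK.phi μ (h + g * Real.sqrt (2 * q * t)) (-(q * t))
                  ∂(gaussianReal 0 1))) := by
  refine ⟨1 / 128, by norm_num, fun μ _ hμ _ h t ht htc =>
    ⟨fun n => GeneralSpinSK.integrable_log_partitionFunction h hμ ht, ?_⟩⟩
  obtain ⟨q, hq, hfix⟩ := GeneralSpinSK.exists_qlin_eq hμ h t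
  set C := ∫ z, Real.exp (z ^ 2 / 4) ∂(gaussianReal 0 1)
  have key : ∀ {q : ℝ} (hq : 0 ≤ q), GeneralSpinSK.qlin μ h (2 * q * t) = q → ∀ {n : ℕ}, 0 < n → _ :=
    fun {q} hq hfix {n} hn => GeneralSpinSK.overlapVar_le_and_logZ_ge h hμ ht hq hn htc
      (GeneralSpinSK.logZ_pairPath_zero_le h hμ ht hq hn hfix (2 * t))
  refine ⟨q, ⟨hq, hfix⟩, fun q' hq' hfix' => ?_,
    GeneralSpinSK.integrable_phi hμ h _ _, ?_⟩
  · have hle : (q' - q) ^ 2 ≤ 0 := by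
      refine ge_of_tendsto (GeneralSpinSK.tendsto_const_div_natCast (512 * C)) ?_
      filter_upwards [eventually_gt_atTop 0] with n hn
      have h1 := (key hq hfix hn).1
      have h2 := (key hq' hfix' hn).1
      have h3 := GeneralSpinSK.sq_sub_le_overlapVar_add (n := n) h hμ ht hq hq'
      have h4 : 512 * C / (n : ℝ) = 4 * (128 * C / n) := by ring
      rw [h4]
      linarith
    have : q' - q = 0 := pow_eq_zero_iff two_ne_zero |>.1 (le_antisymm hle (sq_nonneg _))
    linarith
  · set A := ∫ g, GeneralSpinSK.phi μ (h + g * √(2 * q * t)) (-(q * t)) ∂(gaussianReal 0 1)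
    -- The upper bound on the free energy is exact for every `n > 0`; the lower bound loses only `C
    -- / (2n)`.
    have hlow : Tendsto (fun n : ℕ => t / 2 * q ^ 2 + A - (C / 2) / (n : ℝ)) atTop
        (𝓝 (t / 2 * q ^ 2 + A)) := by
      simpa using (GeneralSpinSK.tendsto_const_div_natCast (C / 2)).const_sub (t / 2 * q ^ 2 + A)
    refine tendsto_of_tendsto_of_tendsto_of_le_of_le' hlow tendsto_const_nhds ?_ ?_
    all_goals
      filter_upwards [eventually_gt_atTop 0] with n hn
      have hn' : (0 : ℝ) < n := by exact_mod_cast hn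
      obtain ⟨-, h1, h2⟩ := key hq hfix hn
      rw [GeneralSpinSK.logZ_singlePath_zero, GeneralSpinSK.logZ_singlePath_pi_div_two] at h1 h2
      unfold GeneralSpinSK.freeEnergy
      rw [one_div_mul_eq_div]
    · rw [le_div_iff₀ hn', sub_mul, div_mul_cancel₀ _ hn'.ne']
      linarith
    · rw [div_le_iff₀ hn']
      linarith
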